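/- Fix $\tau,\eta\in\mathbb C$ with $\operatorname{Im}\tau>0$ and $2\eta\notin\mathbb Z+\tau\mathbb Z$, and let $$\theta(t)=-\sum_{j\in\mathbb Z}e^{\pi i(j+\frac12)^2\tau+2\pi i(j+\frac12)(t+\frac12)} .$$ For $\Lambda,z\in\mathbb C$, the evaluation Verma module $V_\Lambda(z)$ of the elliptic quantum group $E_{\tau,\eta}(sl_2)$ has basis $e_0,e_1,e_2,\dots$ (with $e_{-1}=0$), $he_k=(\Lambda-2k)e_k$, and $L$-operator $L(w,\lambda)$ on $V\otimes V_\Lambda(z)$, where $V=\mathbb Ce[1]\oplus\mathbb Ce[-1]$ and $he[\pm1]=\pm e[\pm1]$, given by $$L(w,\lambda)(e[1]\otimes e_k)=e[1]\otimes a(w,\lambda)e_k+e[-1]\otimes c(w,\lambda)e_k,\qquad L(w,\lambda)(e[-1]\otimes e_k)=e[1]\otimes b(w,\lambda)e_k+e[-1]\otimes d(w,\lambda)e_k,$$ $$a(w,\lambda)e_k=\frac{\theta(z-w+(\Lambda+1-2k)\eta)\,\theta(\lambda+2k\eta)}{\theta(z-w+(\Lambda+1)\eta)\,\theta(\lambda)}\,e_k,\qquad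 b(w,\lambda)e_k=-\frac{\theta(-\lambda+z-w+(\Lambda-1-2k)\eta)\,\theta(2\eta)}{\theta(z-w+(\Lambda+1)\eta)\,\theta(\lambda)}\,e_{k+1},$$ $$c(w,\lambda)e_k=-\frac{\theta(-\lambda-z+w+(\Lambda+1-2k)\eta)\,\theta(2(\Lambda+1-k)\eta)\,\theta(2k\eta)}{\theta(z-w+(\Lambda+1)\eta)\,\theta(\lambda)\,\theta(2\eta)}\,e_{k-1},\qquad d(w,\lambda)e_k=\frac{\theta(z-w+(-\Lambda+1+2k)\eta)\,\theta(\lambda-2(\Lambda-k)\eta)}{\theta(z-w+(\Lambda+1)\eta)\,\theta(\lambda)}\,e_k .$$ Let $\Lambda_1,\dots,\Lambda_n,z_1,\dots,z_n\in\mathbb C$ and let $W=V_{\Lambda_1}(z_1)\otimes\cdots\otimes V_{\Lambda_n}(z_n)$, with $L$-operator on $V\otimes W$ (the factor $V$ has number $0$) $$L(w,\lambda)=L_1^{(01)}\Bigl(w,\lambda-2\eta\sum_{l=2}^nh^{(l)}\Bigr)\cdots L_{n-1}^{(0,n-1)}\bigl(w,\lambda-2\eta h^{(n)}\bigr)\,L_n^{(0n)}(w,\lambda),$$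 where $L_k$ is the $L$-operator of $V_{\Lambda_k}(z_k)$ and $h^{(l)}$ is $h$ acting on the $l$-th factor. The operator $b(w)$ acts on meromorphic functions $f$ of $\lambda\in\mathbb C$ with values in $W$: $(b(w)f)(\lambda)$ is the $e[1]$-component of $L(w,\lambda)\bigl(e[-1]\otimes f(\lambda+2\eta)\bigr)$. Put $p_k=z_k+\eta(-\Lambda_k+1)$, $q_k=z_k+\eta(\Lambda_k+1)$, and for $m\ge 0$ and $c\in\mathbb C$ put $$v(\lambda)=e^{c\lambda}\prod_{j=1}^m\frac{\theta(\lambda-2\eta j)}{\theta(2\eta)}\;e_0\otimes\cdots\otimes e_0 .$$ Let $t_1,\dots,t_m\in\mathbb C$ be such that $t_i\ne t_j \bmod \mathbb Z+\tau\mathbb Z$ for $i<j$ and $t_i\neq q_k\bmod\mathbb Z+\tau\mathbb Z$ for all $i,k$. Then, as meromorphic functions of $\lambda$, $$b(t_1)\cdots b(t_m)v=(-1)^me^{c(\lambda+2\eta m)}\sum_{I_1,\dots,I_n}\;\prod_{l=1}^n\prod_{i\in I_l}\prod_{k=l+1}^n\frac{\theta(t_i-p_k)}{\theta(t_i-q_k)}\;\prod_{k<l}\prod_{i\in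 I_k,\,j\in I_l}\frac{\theta(t_i-t_j-2\eta)}{\theta(t_i-t_j)}$$ $$\qquad\times\prod_{k=1}^n\prod_{j\in I_k}\frac{\theta\bigl(\lambda+t_j-q_k+2\eta m_k-2\eta\sum_{l=k+1}^n(\Lambda_l-2m_l)\bigr)}{\theta(t_j-q_k)}\;e_{m_1}\otimes\cdots\otimes e_{m_n},$$ where the sum is over all partitions of $\{1,\dots,m\}$ into $n$ disjoint (possibly empty) subsets $I_1,\dots,I_n$ and $m_k=|I_k|$. In particular $b(t_1)\cdots b(t_m)v$ extends to an entire function $\psi$ of $\lambda$ with values in $W$, and $\psi(\lambda+1)=(-1)^me^c\psi(\lambda)$ for all $\lambda\in\mathbb C$. -/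

import Mathlib

noncomputable section

namespace EllipticBethe

/-- Jacobi's theta function
`θ(t) = -∑_{j ∈ ℤ} exp (π i (j + 1/2)² τ + 2 π i (j + 1/2) (t + 1/2))`. -/
def theta (τ t : ℂ) : ℂ :=
  -∑' j : ℤ, Complex.exp
    (Real.pi * Complex.I * ((j : ℂ) + 1 / 2) ^ 2 * τ
      + 2 * Real.pi * Complex.I * ((j : ℂ) + 1 / 2) * (t + 1 / 2))

/-- The lattice `ℤ + τ ℤ`. -/
def lattice (τ : ℂ) : Set ℂ := {u | ∃ a b : ℤ, u = a + b * τ}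

/-- `p = z + η (-Λ + 1)`. -/
def pPar (η Λ z : ℂ) : ℂ := z + η * (-Λ + 1)

/-- `q = z + η (Λ + 1)`. -/
def qPar (η Λ z : ℂ) : ℂ := z + η * (Λ + 1)

/-! ### The evaluation Verma module `V_Λ(z)`

It has basis `e_0, e_1, …` with `h e_k = (Λ - 2k) e_k`. The auxiliary two dimensional space `V` has
basis `e[1], e[-1]`, indexed by `ℤˣ = {1, -1}`, with `h e[α] = α e[α]`. If a space `W` has a basis
indexed by `B`, then `W` is modelled by `B →₀ ℂ` and `V ⊗ W` by `(ℤˣ × B) →₀ ℂ`, with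
`e[α] ⊗ e_b` being `Finsupp.single (α, b) 1`.

The matrix elements of the `L`-operator at spectral parameter `w` and dynamical parameter `x` (the
variable usually called `λ`) are
`a(w,x) e_k = vermaA e_k`, `b(w,x) e_k = vermaB e_{k+1}`, `c(w,x) e_k = vermaC e_{k-1}` (and
`c(w,x) e_0 = 0`), `d(w,x) e_k = vermaD e_k`. -/

def vermaA (τ η Λ z w x : ℂ) (k : ℕ) : ℂ :=
  theta τ (z - w + (Λ + 1 - 2 * k) * η) / theta τ (z - w + (Λ + 1) * η)
    * (theta τ (x + 2 * k * η) / theta τ x)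

def vermaB (τ η Λ z w x : ℂ) (k : ℕ) : ℂ :=
  -(theta τ (-x + z - w + (Λ - 1 - 2 * k) * η) / theta τ (z - w + (Λ + 1) * η)
    * (theta τ (2 * η) / theta τ x))

def vermaC (τ η Λ z w x : ℂ) (k : ℕ) : ℂ :=
  -(theta τ (-x - z + w + (Λ + 1 - 2 * k) * η) / theta τ (z - w + (Λ + 1) * η)
    * (theta τ (2 * (Λ + 1 - k) * η) / theta τ x)
    * (theta τ (2 * k * η) / theta τ (2 * η)))

def vermaD (τ η Λ z w x : ℂ) (k : ℕ) : ℂ :=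
  theta τ (z - w + (-Λ + 1 + 2 * k) * η) / theta τ (z - w + (Λ + 1) * η)
    * (theta τ (x - 2 * (Λ - k) * η) / theta τ x)

/-- The value on `e[α] ⊗ e_k` of the `L`-operator of `V_Λ(z)`:
`L(w,x) (e[1] ⊗ e_k) = e[1] ⊗ a(w,x) e_k + e[-1] ⊗ c(w,x) e_k`,
`L(w,x) (e[-1] ⊗ e_k) = e[1] ⊗ b(w,x) e_k + e[-1] ⊗ d(w,x) e_k`. -/
def vermaLBasis (τ η Λ z w x : ℂ) (α : ℤˣ) (k : ℕ) : (ℤˣ × ℕ) →₀ ℂ :=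
  if α = 1 then
    Finsupp.single (1, k) (vermaA τ η Λ z w x k)
      + (if k = 0 then 0 else Finsupp.single (-1, k - 1) (vermaC τ η Λ z w x k))
  else
    Finsupp.single (1, k + 1) (vermaB τ η Λ z w x k)
      + Finsupp.single (-1, k) (vermaD τ η Λ z w x k)

/-! ### The tensor product `W = V_{Λ_1}(z_1) ⊗ ⋯ ⊗ V_{Λ_n}(z_n)` -/

/-- The underlying vector space of `W`: the basis vector `e_{κ_1} ⊗ ⋯ ⊗ e_{κ_n}` is
`Finsupp.single κ 1`. -/
abbrev TensorSpace (n : ℕ) : Type := (Fin n → ℕ) →₀ ℂ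

/-- `V ⊗ W`. -/
abbrev AuxTensorSpace (n : ℕ) : Type := (ℤˣ × (Fin n → ℕ)) →₀ ℂ

/-- The operator `L_k^{(0k)}(w, x - 2η ∑_{l > k} h^{(l)})` on `V ⊗ W`, where `L_k` is the
`L`-operator of the `k`-th factor `V_{Λ_k}(z_k)`, the auxiliary space `V` has number `0`, and
`h^{(l)}` has the eigenvalue `Λ_l - 2 κ_l` on `e_{κ_1} ⊗ ⋯ ⊗ e_{κ_n}`. -/
def siteL (τ η : ℂ) {n : ℕ} (Λ z : Fin n → ℂ) (w x : ℂ) (k : Fin n) :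
    Module.End ℂ (AuxTensorSpace n) :=
  Finsupp.linearCombination ℂ fun v : ℤˣ × (Fin n → ℕ) =>
    Finsupp.mapDomain (fun u : ℤˣ × ℕ => (u.1, Function.update v.2 k u.2))
      (vermaLBasis τ η (Λ k) (z k) w
        (x - 2 * η * ∑ l ∈ Finset.Ioi k, (Λ l - 2 * (v.2 l : ℂ))) v.1 (v.2 k))

/-- The `L`-operator of the tensor product,
`L(w,x) = L_1^{(01)}(w, x - 2η ∑_{l ≥ 2} h^{(l)}) ⋯ L_{n-1}^{(0,n-1)}(w, x - 2η h^{(n)})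
L_n^{(0n)}(w, x)`. -/
def tensorL (τ η : ℂ) {n : ℕ} (Λ z : Fin n → ℂ) (w x : ℂ) : Module.End ℂ (AuxTensorSpace n) :=
  ((List.finRange n).map (siteL τ η Λ z w x)).prod

/-! ### The operators `a(w), b(w), c(w), d(w)` -/

/-- The vector `e[α] ⊗ v ∈ V ⊗ W`. -/
def auxTensor {n : ℕ} (α : ℤˣ) (v : TensorSpace n) : AuxTensorSpace n :=
  Finsupp.mapDomain (Prod.mk α) v

/-- The vector `v_β` in the decomposition `u = e[1] ⊗ v_1 + e[-1] ⊗ v_{-1}` of `u ∈ V ⊗ W`. -/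
def auxComponent {n : ℕ} (β : ℤˣ) (u : AuxTensorSpace n) : TensorSpace n :=
  Finsupp.comapDomain (Prod.mk β) u (Prod.mk_right_injective β).injOn

/-- The matrix element `e[α] → e[β]` of the operator
`(L̃(w) (e[α] ⊗ f))(x) = L(w,x) (e[α] ⊗ f(x - 2ηα))`.

Meromorphic functions with values in `W` are represented by functions on `ℂ`, two of which
represent the same meromorphic function iff they agree on a codiscrete set (the complement of a
closed discrete set). The values at poles are irrelevant. -/
def entryOp (τ η : ℂ) {n : ℕ} (Λ z : Fin n → ℂ) (β α : ℤˣ) (w : ℂ) (f : ℂ → TensorSpace n) :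
    ℂ → TensorSpace n :=
  fun x => auxComponent β
    (tensorL τ η Λ z w x (auxTensor α (f (x - 2 * η * ((α : ℤ) : ℂ)))))

/-- The operator `b(w)`: `L̃(w) (e[-1] ⊗ f) = e[1] ⊗ b(w) f + e[-1] ⊗ d(w) f`. -/
def bOp (τ η : ℂ) {n : ℕ} (Λ z : Fin n → ℂ) (w : ℂ) (f : ℂ → TensorSpace n) :
    ℂ → TensorSpace n :=
  entryOp τ η Λ z 1 (-1) w f

/-! ### The Bethe vector and the explicit formula -/

/-- The function `v(x) = e^{c x} ∏_{j=1}^m (θ(x - 2ηj) / θ(2η)) v_0`, where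
`v_0 = e_0 ⊗ ⋯ ⊗ e_0` is the highest weight vector. -/
def startVector (τ η : ℂ) (n m : ℕ) (c : ℂ) : ℂ → TensorSpace n :=
  fun x => Finsupp.single (fun _ => 0)
    (Complex.exp (c * x)
      * ∏ j ∈ Finset.Icc 1 m, (theta τ (x - 2 * η * (j : ℂ)) / theta τ (2 * η)))

/-- The Bethe vector `b(t_1) ⋯ b(t_m) v`. -/
def betheVector (τ η : ℂ) {n m : ℕ} (Λ z : Fin n → ℂ) (c : ℂ) (t : Fin m → ℂ) :
    ℂ → TensorSpace n :=
  (List.finRange m).foldr (fun i f => bOp τ η Λ z (t i) f) (startVector τ η n m c)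

/-- The ordered partitions `(I_1, …, I_n)` of `{1, …, m}` into `n` disjoint, possibly empty,
subsets. -/
def partitions (n m : ℕ) : Finset (Fin n → Finset (Fin m)) :=
  open Classical in Finset.univ.filter fun I => ∀ i, ∃! l, i ∈ I l

/-- The coefficient of `e_{m_1} ⊗ ⋯ ⊗ e_{m_n}` contributed by the partition `I`, where
`m_k = |I_k|`. -/
def betheCoeff (τ η : ℂ) {n m : ℕ} (Λ z : Fin n → ℂ) (t : Fin m → ℂ)
    (I : Fin n → Finset (Fin m)) (x : ℂ) : ℂ :=
  (∏ l, ∏ i ∈ I l, ∏ k ∈ Finset.Ioi l,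
      theta τ (t i - pPar η (Λ k) (z k)) / theta τ (t i - qPar η (Λ k) (z k)))
    * (∏ k, ∏ l ∈ Finset.Ioi k, ∏ i ∈ I k, ∏ j ∈ I l,
        theta τ (t i - t j - 2 * η) / theta τ (t i - t j))
    * ∏ k, ∏ j ∈ I k,
        theta τ (x + t j - qPar η (Λ k) (z k) + 2 * η * ((I k).card : ℂ)
            - 2 * η * ∑ l ∈ Finset.Ioi k, (Λ l - 2 * ((I l).card : ℂ)))
          / theta τ (t j - qPar η (Λ k) (z k))

/-- A `W`-valued function is entire if it takes its values in the span of finitely many basis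
vectors and its coordinates are entire functions. -/
def IsEntire {n : ℕ} (f : ℂ → TensorSpace n) : Prop :=
  (∃ S : Finset (Fin n → ℕ), ∀ x, (f x).support ⊆ S) ∧
    ∀ κ, Differentiable ℂ fun x => f x κ

end EllipticBethe

end

noncomputable section

namespace EllipticBethe

/-! ### The theta function -/

/-! Work with a set `T` of variables instead of the whole list. For each `T` there is a vector
`weightVector` Ψ_T(x), defined by peeling off the last tensor factor: each subset K of `T` is
attached to that factor, giving `e_{|K|}`, and T \ K is distributed over the remaining factors, with
x shifted by the weight of `e_{|K|}`. Unfolding this recursion gives exactly the sum over ordered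
partitions (`weightVector_eq_sum`). The heart of the matter is that b(t₀) sends Ψ_T(x + 2η) to
-(θ(2η)/θ(x)) Ψ_{T ∪ {t₀}}(x) (`RaisesAt`). Iterating from Ψ_∅ = e_0 ⊗ ⋯ ⊗ e_0, the denominators
θ(x) accumulate into a product which the theta factors of the starting vector cancel. Since Ψ_T
depends only on the set `T`, the order of the operators does not enter the formula.

The raising property is proved by induction on the number of factors. On v ⊗ e_k the operator b acts
through a ⊗ b and b ⊗ d, so the action of a on Ψ_T is needed too. It has the familiar Bethe ansatz
shape (`ExchangesAt`): a diagonal term, plus terms in which t₀ replaces some t_j. As a acts through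
a ⊗ a and b ⊗ c, the two properties form a simultaneous induction
(`eventually_raisesAt_and_exchangesAt`). Comparing the coefficients of each vector Ψ ⊗ e_k leaves
scalar identities between theta functions (`raising_identity`, `exchange_identity`).

These identities are partial fraction expansions (`residueSum_eq_zero`), supplemented by the
three-term relation. The expansions are themselves obtained algebraically from that relation, by
interpolation and induction on the number of nodes. The relation also shows that θ vanishes only on
the lattice, which turns the hypotheses on η and the t_i into nonvanishing of denominators. Zeros of
theta functions of x are avoided by arguing off closed discrete sets. -/

/-- The general term of the series `-θ(t)`. -/
def thetaTerm (τ t : ℂ) (j : ℤ) : ℂ :=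
  Complex.exp (Real.pi * Complex.I * ((j : ℂ) + 1 / 2) ^ 2 * τ
      + 2 * Real.pi * Complex.I * ((j : ℂ) + 1 / 2) * (t + 1 / 2))

/-- The part of the theta series of modulus `τ / 2` indexed by even integers. -/
def thetaEven (τ x : ℂ) : ℂ := jacobiTheta₂ (2 * x) (2 * τ)

/-- The part of the theta series of modulus `τ / 2` indexed by odd integers. -/
def thetaOdd (τ x : ℂ) : ℂ :=
  Complex.exp (Real.pi * Complex.I * τ / 2 + 2 * Real.pi * Complex.I * x)
    * jacobiTheta₂ (2 * x + τ) (2 * τ)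

lemma thetaTerm_eq (τ t : ℂ) (j : ℤ) :
    thetaTerm τ t j = Complex.exp (Real.pi * Complex.I * (τ / 4 + t + 1 / 2))
      * jacobiTheta₂_term j (t + 1 / 2 + τ / 2) τ := by
  rw [thetaTerm, jacobiTheta₂_term, ← Complex.exp_add]
  congr 1
  ring

lemma theta_eq_jacobiTheta₂ (τ t : ℂ) :
    theta τ t = -(Complex.exp (Real.pi * Complex.I * (τ / 4 + t + 1 / 2))
      * jacobiTheta₂ (t + 1 / 2 + τ / 2) τ) := by
  rw [theta, jacobiTheta₂, ← tsum_mul_left]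
  congr 1
  exact tsum_congr fun j => thetaTerm_eq τ t j

lemma hasSum_thetaTerm {τ : ℂ} (hτ : 0 < τ.im) (t : ℂ) :
    HasSum (thetaTerm τ t) (-theta τ t) := by
  rw [theta_eq_jacobiTheta₂, neg_neg]
  exact ((hasSum_jacobiTheta₂_term _ hτ).mul_left _).congr_fun (thetaTerm_eq τ t)

lemma differentiable_theta {τ : ℂ} (hτ : 0 < τ.im) : Differentiable ℂ (theta τ) := by
  have : theta τ = fun t => -(Complex.exp (Real.pi * Complex.I * (τ / 4 + t + 1 / 2))
      * jacobiTheta₂ (t + 1 / 2 + τ / 2) τ) := funext (theta_eq_jacobiTheta₂ τ)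
  rw [this]
  have h : Differentiable ℂ fun t : ℂ => jacobiTheta₂ (t + 1 / 2 + τ / 2) τ := fun t =>
    (differentiableAt_jacobiTheta₂_fst (t + 1 / 2 + τ / 2) hτ).comp t
      (f := fun t : ℂ => t + 1 / 2 + τ / 2) (by fun_prop)
  fun_prop

lemma theta_add_one (τ t : ℂ) : theta τ (t + 1) = -theta τ t := by
  rw [theta_eq_jacobiTheta₂, theta_eq_jacobiTheta₂,
    show t + 1 + 1 / 2 + τ / 2 = t + 1 / 2 + τ / 2 + 1 by ring, jacobiTheta₂_add_left,
    show (Real.pi : ℂ) * Complex.I * (τ / 4 + (t + 1) + 1 / 2)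
      = Real.pi * Complex.I * (τ / 4 + t + 1 / 2) + Real.pi * Complex.I by ring,
    Complex.exp_add, Complex.exp_pi_mul_I]
  ring

lemma theta_add_tau (τ t : ℂ) :
    theta τ (t + τ) = -Complex.exp (-(Real.pi * Complex.I * (τ + 2 * t))) * theta τ t := by
  have h : Complex.exp (Real.pi * Complex.I) = -1 := Complex.exp_pi_mul_I
  rw [theta_eq_jacobiTheta₂, theta_eq_jacobiTheta₂,
    show t + τ + 1 / 2 + τ / 2 = t + 1 / 2 + τ / 2 + τ by ring, jacobiTheta₂_add_left']
  rw [show -(Real.pi : ℂ) * Complex.I * (τ + 2 * (t + 1 / 2 + τ / 2))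
      = -(Real.pi * Complex.I * (τ + 2 * t)) + -(Real.pi * Complex.I * τ)
        + -(Real.pi * Complex.I) by ring,
    show (Real.pi : ℂ) * Complex.I * (τ / 4 + (t + τ) + 1 / 2)
      = Real.pi * Complex.I * (τ / 4 + t + 1 / 2) + Real.pi * Complex.I * τ by ring]
  simp only [Complex.exp_add, Complex.exp_neg, h]
  field_simp

/-- The series `jacobiTheta₂` is even; its quasi-periods τ and 1 carry the reflected argument back,
and their factors leave the sign. -/
lemma theta_neg (τ t : ℂ) : theta τ (-t) = -theta τ t := by
  rw [theta_eq_jacobiTheta₂, theta_eq_jacobiTheta₂, ← jacobiTheta₂_neg_left,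
    show -(-t + 1 / 2 + τ / 2) = (t - 1 / 2 - τ / 2) by ring]
  have h1 := jacobiTheta₂_add_left' (t - 1 / 2 - τ / 2) τ
  have h2 := jacobiTheta₂_add_left (t - 1 / 2 + τ / 2) τ
  rw [show t - 1 / 2 + τ / 2 + 1 = t + 1 / 2 + τ / 2 by ring] at h2
  rw [show t - 1 / 2 - τ / 2 + τ = t - 1 / 2 + τ / 2 by ring] at h1
  rw [h2, h1, ← mul_assoc, ← Complex.exp_add,
    show (Real.pi : ℂ) * Complex.I * (τ / 4 + t + 1 / 2)
      + -Real.pi * Complex.I * (τ + 2 * (t - 1 / 2 - τ / 2))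
      = Real.pi * Complex.I * (τ / 4 + -t + 1 / 2) + Real.pi * Complex.I by ring,
    Complex.exp_add _ (Real.pi * Complex.I), Complex.exp_pi_mul_I]
  ring

lemma theta_sub_comm (τ a b : ℂ) : theta τ (a - b) = -theta τ (b - a) := by
  rw [← theta_neg, neg_sub]

@[simp] lemma theta_zero (τ : ℂ) : theta τ 0 = 0 := by
  have := theta_neg τ 0
  rw [neg_zero] at this
  exact self_eq_neg.mp this

/-- Pairs of integers, split according to the parity of the sum of the entries. -/
def parityEquiv : (ℤ × ℤ) ⊕ (ℤ × ℤ) ≃ ℤ × ℤ where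
  toFun := Sum.elim (fun u => (u.1 + u.2, u.1 - u.2 - 1)) (fun u => (u.1 + u.2, u.1 - u.2))
  invFun p := if Even (p.1 + p.2) then Sum.inr ((p.1 + p.2) / 2, (p.1 - p.2) / 2)
    else Sum.inl ((p.1 + p.2 + 1) / 2, (p.1 - p.2 - 1) / 2)
  left_inv := by
    rintro (⟨u, v⟩ | ⟨u, v⟩)
    · have h : ¬ Even (u + v + (u - v - 1)) := by rw [Int.even_iff]; lia
      simp only [Sum.elim_inl, h, if_false, Sum.inl.injEq, Prod.mk.injEq]
      lia
    · have h : Even (u + v + (u - v)) := by rw [Int.even_iff]; lia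
      simp only [Sum.elim_inr, h, if_true, Sum.inr.injEq, Prod.mk.injEq]
      lia
  right_inv := by
    rintro ⟨j, k⟩
    by_cases h : Even (j + k)
    · simp only [h, if_true, Sum.elim_inr, Prod.mk.injEq]
      rw [Int.even_iff] at h
      lia
    · simp only [h, if_false, Sum.elim_inl, Prod.mk.injEq]
      rw [Int.even_iff] at h
      lia

/-! ### The addition formula and the three-term relation -/

lemma hasSum_thetaEven {τ : ℂ} (hτ : 0 < τ.im) (x : ℂ) :
    HasSum (fun u : ℤ => Complex.exp (Real.pi * Complex.I * τ * (2 * u) ^ 2 / 2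
      + 2 * Real.pi * Complex.I * (2 * u) * x)) (thetaEven τ x) := by
  have h2 : 0 < (2 * τ).im := by simpa using hτ
  refine (hasSum_jacobiTheta₂_term (2 * x) h2).congr_fun fun u => ?_
  rw [jacobiTheta₂_term]
  congr 1
  ring

lemma hasSum_thetaOdd {τ : ℂ} (hτ : 0 < τ.im) (x : ℂ) :
    HasSum (fun u : ℤ => Complex.exp (Real.pi * Complex.I * τ * (2 * u + 1) ^ 2 / 2
      + 2 * Real.pi * Complex.I * (2 * u + 1) * x)) (thetaOdd τ x) := by
  have h2 : 0 < (2 * τ).im := by simpa using hτ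
  refine ((hasSum_jacobiTheta₂_term (2 * x + τ) h2).mul_left _).congr_fun fun u => ?_
  rw [jacobiTheta₂_term, ← Complex.exp_add]
  congr 1
  ring

lemma hasSum_mul_prod {f g : ℤ → ℂ} {a b : ℂ} (hf : HasSum f a) (hg : HasSum g b) :
    HasSum (fun p : ℤ × ℤ => f p.1 * g p.2) (a * b) :=
  hf.mul hg (summable_mul_of_summable_norm hf.summable.norm hg.summable.norm)

/-- The addition formula for the theta function. -/
lemma theta_add_mul_theta_sub {τ : ℂ} (hτ : 0 < τ.im) (x y : ℂ) :
    theta τ (x + y) * theta τ (x - y)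
      = thetaEven τ x * thetaOdd τ y - thetaOdd τ x * thetaEven τ y := by
  -- With J = j + 1/2 and K = k + 1/2, the integers N = J + K and M = J - K have opposite parity, J²
  -- + K² = (N² + M²)/2, and the halves added to the arguments give the sign (-1)^N. Even N and odd
  -- N produce the two products on the right.
  have h := hasSum_mul_prod (hasSum_thetaTerm hτ (x + y)) (hasSum_thetaTerm hτ (x - y))
  rw [neg_mul_neg, ← parityEquiv.hasSum_iff] at h
  have h1 := hasSum_mul_prod (hasSum_thetaEven hτ x) (hasSum_thetaOdd hτ y)
  have h2 := (hasSum_mul_prod (hasSum_thetaOdd hτ x) (hasSum_thetaEven hτ y)).neg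
  rw [sub_eq_add_neg]
  refine h.unique (HasSum.sum (h1.congr_fun ?_) (h2.congr_fun ?_))
  · rintro ⟨u, v⟩
    simp only [Function.comp_apply, parityEquiv, Equiv.coe_fn_mk, Sum.elim_inl, thetaTerm,
      ← Complex.exp_add]
    rw [Complex.exp_eq_exp_iff_exists_int]
    refine ⟨u, ?_⟩
    push_cast
    ring
  · rintro ⟨u, v⟩
    simp only [Function.comp_apply, parityEquiv, Equiv.coe_fn_mk, Sum.elim_inr, thetaTerm,
      ← Complex.exp_add]
    rw [neg_eq_neg_one_mul, ← Complex.exp_pi_mul_I, ← Complex.exp_add,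
      Complex.exp_eq_exp_iff_exists_int]
    refine ⟨u, ?_⟩
    push_cast
    ring

/-- The three-term identity. -/
lemma theta_three_term {τ : ℂ} (hτ : 0 < τ.im) (x y u v : ℂ) :
    theta τ (x + y) * theta τ (x - y) * (theta τ (u + v) * theta τ (u - v))
      = theta τ (x + v) * theta τ (x - v) * (theta τ (u + y) * theta τ (u - y))
        - theta τ (x + u) * theta τ (x - u) * (theta τ (v + y) * theta τ (v - y)) := by
  -- Each product θ(x + y) θ(x - y) is the determinant of the vectors (`thetaEven`, `thetaOdd`) at x
  -- and y, so this is the Plücker relation for four vectors in the plane.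
  simp only [theta_add_mul_theta_sub hτ]
  ring

/-- The three-term identity for eight arguments. -/
lemma theta_three_term_of_eq {τ : ℂ} (hτ : 0 < τ.im) {a₁ a₂ a₃ a₄ b₁ b₂ b₃ b₄ c₁ c₂ c₃ c₄ : ℂ}
    (x y u v : ℂ) (h1 : a₁ = x + y := by ring) (h2 : a₂ = x - y := by ring)
    (h3 : a₃ = u + v := by ring) (h4 : a₄ = u - v := by ring)
    (h5 : b₁ = x + v := by ring) (h6 : b₂ = x - v := by ring)
    (h7 : b₃ = u + y := by ring) (h8 : b₄ = u - y := by ring)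
    (h9 : c₁ = x + u := by ring) (h10 : c₂ = x - u := by ring)
    (h11 : c₃ = v + y := by ring) (h12 : c₄ = v - y := by ring) :
    theta τ a₁ * theta τ a₂ * (theta τ a₃ * theta τ a₄)
      = theta τ b₁ * theta τ b₂ * (theta τ b₃ * theta τ b₄)
        - theta τ c₁ * theta τ c₂ * (theta τ c₃ * theta τ c₄) := by
  subst_vars
  exact theta_three_term hτ x y u v

end EllipticBethe

end

noncomputable section

namespace EllipticBethe

open Filter Topology

/-! ### Codiscrete sets -/

lemma eventually_nhdsNE_of_codiscrete {p : ℂ → Prop} (h : ∀ᶠ x in codiscrete ℂ, p x) (x : ℂ) :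
    ∀ᶠ y in 𝓝[≠] x, p y := by
  have := (mem_codiscrete.mp h) x
  rwa [Filter.disjoint_principal_right, compl_compl] at this

/-- The operators shift the dynamical parameter, so identities known off a closed discrete set must
be available at translated points. -/
lemma tendsto_add_right_codiscrete (a : ℂ) :
    Tendsto (fun x : ℂ => x + a) (codiscrete ℂ) (codiscrete ℂ) := by
  intro s hs
  rw [mem_map, mem_codiscrete]
  intro x
  rw [Filter.disjoint_principal_right, compl_compl]
  have h := eventually_nhdsNE_of_codiscrete hs (x + a)
  have ht : Tendsto (fun x : ℂ => x + a) (𝓝[≠] x) (𝓝[≠] (x + a)) :=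
    (Continuous.tendsto (by fun_prop) x).inf
      (tendsto_principal_principal.mpr fun y hy => by simpa using hy)
  exact ht h

lemma eq_of_eventuallyEq_codiscrete {f g : ℂ → ℂ} {x : ℂ} (hf : ContinuousAt f x)
    (hg : ContinuousAt g x) (h : f =ᶠ[codiscrete ℂ] g) : f x = g x := by
  have h1 : f =ᶠ[𝓝[≠] x] g := eventually_nhdsNE_of_codiscrete h x
  exact tendsto_nhds_unique_of_eventuallyEq (hf.tendsto.mono_left nhdsWithin_le_nhds)
    (hg.tendsto.mono_left nhdsWithin_le_nhds) h1

/-! ### The zeros of the theta function -/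

lemma integral_jacobiTheta₂_term (τ : ℂ) (n : ℤ) :
    ∫ x in (0 : ℝ)..1, jacobiTheta₂_term n x τ = if n = 0 then 1 else 0 := by
  split_ifs with hn
  · simp [jacobiTheta₂_term, hn]
  · have hc : 2 * Real.pi * Complex.I * n ≠ 0 := by
      simp [hn, Real.pi_ne_zero]
    simp only [jacobiTheta₂_term, Complex.exp_add, intervalIntegral.integral_mul_const,
      integral_exp_mul_complex hc]
    have : Complex.exp (2 * Real.pi * Complex.I * n * (1 : ℝ)) = 1 := by
      rw [Complex.exp_eq_one_iff]
      exact ⟨n, by push_cast; ring⟩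
    rw [this]
    simp

/-- The constant Fourier coefficient is 1; this is how θ is seen not to vanish identically. -/
lemma integral_jacobiTheta₂ {τ : ℂ} (hτ : 0 < τ.im) :
    ∫ x in (0 : ℝ)..1, jacobiTheta₂ x τ = 1 := by
  have h : HasSum (fun n : ℤ => ∫ x in (0 : ℝ)..1, jacobiTheta₂_term n x τ)
      (∫ x in (0 : ℝ)..1, jacobiTheta₂ x τ) := by
    -- For real x the norm of a term does not depend on x, so the terms at 0 dominate.
    refine intervalIntegral.hasSum_integral_of_dominated_convergence
      (fun n _ => ‖jacobiTheta₂_term n 0 τ‖) (fun n => ?_) (fun n => ?_) ?_ ?_ ?_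
    · apply Continuous.aestronglyMeasurable
      unfold jacobiTheta₂_term
      fun_prop
    · refine Eventually.of_forall fun x _ => le_of_eq ?_
      rw [norm_jacobiTheta₂_term, norm_jacobiTheta₂_term]
      simp
    · exact Eventually.of_forall fun x _ => (hasSum_jacobiTheta₂_term 0 hτ).summable.norm
    · exact intervalIntegrable_const
    · exact Eventually.of_forall fun x _ => hasSum_jacobiTheta₂_term x hτ
  simp only [integral_jacobiTheta₂_term] at h
  exact h.unique (hasSum_ite_eq 0 1)

lemma exists_theta_ne_zero {τ : ℂ} (hτ : 0 < τ.im) : ∃ x, theta τ x ≠ 0 := by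
  by_contra! h
  have h0 : ∀ x : ℝ, jacobiTheta₂ x τ = 0 := fun x => by
    have := h (x - 1 / 2 - τ / 2)
    rw [theta_eq_jacobiTheta₂, show (x : ℂ) - 1 / 2 - τ / 2 + 1 / 2 + τ / 2 = x by ring] at this
    simpa using this
  have := integral_jacobiTheta₂ hτ
  simp [h0] at this

lemma eventually_ne_zero_of_differentiable {f : ℂ → ℂ} (hf : Differentiable ℂ f)
    (h : ∃ x, f x ≠ 0) : ∀ᶠ x in codiscrete ℂ, f x ≠ 0 := by
  obtain ⟨x, hx⟩ := h
  exact ((Complex.analyticOnNhd_univ_iff_differentiable.mpr hf).eqOn_zero_or_eventually_ne_zero_of_preconnected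
    isPreconnected_univ).resolve_left fun h0 => hx (h0 (Set.mem_univ x))

lemma eventually_theta_add_ne_zero {τ : ℂ} (hτ : 0 < τ.im) (a : ℂ) :
    ∀ᶠ x in codiscrete ℂ, theta τ (x + a) ≠ 0 :=
  (tendsto_add_right_codiscrete a).eventually
    (eventually_ne_zero_of_differentiable (differentiable_theta hτ) (exists_theta_ne_zero hτ))

lemma eventually_theta_sub_ne_zero {τ : ℂ} (hτ : 0 < τ.im) (a : ℂ) :
    ∀ᶠ x in codiscrete ℂ, theta τ (x - a) ≠ 0 := by
  simpa only [sub_eq_add_neg] using eventually_theta_add_ne_zero hτ (-a)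

lemma eventually_theta_ne_zero {τ : ℂ} (hτ : 0 < τ.im) :
    ∀ᶠ x in codiscrete ℂ, theta τ x ≠ 0 := by
  simpa only [add_zero] using eventually_theta_add_ne_zero hτ 0

instance codiscrete_neBot : (codiscrete ℂ).NeBot :=
  ⟨fun h => by
    have : ∀ᶠ x in codiscrete ℂ, False := by rw [h]; exact Filter.eventually_bot
    obtain ⟨_, h⟩ := (eventually_nhdsNE_of_codiscrete this 0).exists
    exact h⟩

/-- Two entire functions, not identically zero, whose logarithmic derivatives differ by a
constant `α` differ by a factor `C exp (α x)`. -/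
lemma eq_const_mul_exp_of_wronskian {f g : ℂ → ℂ} (hf : Differentiable ℂ f)
    (hg : Differentiable ℂ g) {x₀ : ℂ} (hx : g x₀ ≠ 0) (α : ℂ)
    (h : ∀ x, deriv f x * g x - f x * deriv g x = α * (f x * g x)) :
    ∃ C, ∀ x, f x = C * Complex.exp (α * x) * g x := by
  obtain ⟨r, hr, hball⟩ := Metric.eventually_nhds_iff_ball.mp
    (hg.continuous.continuousAt.eventually_ne hx)
  -- On a ball where g has no zero this quotient has derivative 0; the identity theorem then extends
  -- the resulting relation to the whole plane.
  let φ : ℂ → ℂ := fun x => f x / (Complex.exp (α * x) * g x)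
  have hne : ∀ x ∈ Metric.ball x₀ r, Complex.exp (α * x) * g x ≠ 0 := fun x hx =>
    mul_ne_zero (Complex.exp_ne_zero _) (hball x hx)
  have hd : ∀ x ∈ Metric.ball x₀ r, HasDerivAt φ 0 x := fun x hx => by
    have he : HasDerivAt (fun x : ℂ => Complex.exp (α * x)) (Complex.exp (α * x) * α) x := by
      simpa using ((hasDerivAt_id x).const_mul α).cexp
    have := (hf x).hasDerivAt.div (he.mul (hg x).hasDerivAt) (hne x hx)
    refine this.congr_deriv ?_
    rw [div_eq_zero_iff]
    left
    simp only [Pi.mul_apply]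
    linear_combination Complex.exp (α * x) * h x
  have hconst : ∀ x ∈ Metric.ball x₀ r, φ x = φ x₀ := fun x hx =>
    Metric.isOpen_ball.is_const_of_deriv_eq_zero (convex_ball x₀ r).isPreconnected
      (fun y hy => (hd y hy).differentiableAt.differentiableWithinAt)
      (fun y hy => (hd y hy).deriv) hx (Metric.mem_ball_self hr)
  refine ⟨φ x₀, fun x => ?_⟩
  have hev : f =ᶠ[𝓝 x₀] fun x => φ x₀ * Complex.exp (α * x) * g x := by
    filter_upwards [Metric.ball_mem_nhds x₀ hr] with y hy
    rw [← hconst y hy, mul_assoc]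
    exact (div_mul_cancel₀ _ (hne y hy)).symm
  exact congr_fun ((Complex.analyticOnNhd_univ_iff_differentiable.mpr hf).eq_of_eventuallyEq
    (Complex.analyticOnNhd_univ_iff_differentiable.mpr (by fun_prop)) hev) x

/-- The theta function vanishes only at the points of the lattice. -/
lemma mem_lattice_of_theta_eq_zero {τ : ℂ} (hτ : 0 < τ.im) {a : ℂ} (ha : theta τ a = 0) :
    a ∈ lattice τ := by
  have hdiff := differentiable_theta hτ
  have hga : Differentiable ℂ fun x => theta τ (x - a) := by fun_prop
  -- Since θ(a) = 0, one term of the three-term relation drops out. What remains says that F(x) =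
  -- θ(x)/θ(x - a) has a ratio F(p + s)/F(p) independent of p, with denominators cleared.
  have key : ∀ p q s : ℂ, theta τ (p + s) * theta τ (q) * (theta τ (p - a) * theta τ (q + s - a))
      = theta τ p * theta τ (q + s) * (theta τ (p + s - a) * theta τ (q - a)) := by
    intro p q s
    have h := theta_three_term_of_eq hτ (a₁ := a) (a₂ := p - q) (a₃ := p + q + s - a) (a₄ := s)
      (b₁ := p) (b₂ := a - q) (b₃ := q + s) (b₄ := p + s - a)
      (c₁ := p + s) (c₂ := a - (q + s)) (c₃ := q) (c₄ := p - a)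
      ((a + p - q) / 2) ((a - p + q) / 2) ((p + q + 2 * s - a) / 2) ((p + q - a) / 2)
    rw [ha, theta_sub_comm τ a q, theta_sub_comm τ a (q + s)] at h
    linear_combination -h
  -- Differentiating `key` at s = 0 shows that the logarithmic derivative of F is constant, so F is
  -- a multiple of an exponential exp (α x).
  have hW : ∀ p q : ℂ,
      (deriv (theta τ) p * theta τ (p - a) - theta τ p * deriv (theta τ) (p - a))
        * (theta τ q * theta τ (q - a))
      = theta τ p * theta τ (p - a)
        * (deriv (theta τ) q * theta τ (q - a) - theta τ q * deriv (theta τ) (q - a)) := by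
    intro p q
    have hd : ∀ b : ℂ, HasDerivAt (fun s => theta τ (b + s)) (deriv (theta τ) b) 0 := fun b => by
      have h0 : HasDerivAt (theta τ) (deriv (theta τ) b) (b + 0) := by
        rw [add_zero]; exact (hdiff b).hasDerivAt
      exact h0.comp_const_add b 0
    have h1 := ((hd p).mul_const (theta τ q)).mul ((hd (q - a)).const_mul (theta τ (p - a)))
    have h2 := ((hd q).const_mul (theta τ p)).mul ((hd (p - a)).mul_const (theta τ (q - a)))
    have heq : (fun s => theta τ (p + s) * theta τ q) * (fun s => theta τ (p - a)
        * theta τ (q - a + s)) = (fun s => theta τ p * theta τ (q + s)) *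
        fun s => theta τ (p - a + s) * theta τ (q - a) := by
      funext s
      have := key p q s
      rw [add_sub_right_comm, add_sub_right_comm] at this
      exact this
    rw [heq] at h1
    have := h1.unique h2
    simp only [add_zero] at this
    linear_combination this
  obtain ⟨q, hq, hqa⟩ :=
    ((eventually_theta_ne_zero hτ).and (eventually_theta_sub_ne_zero hτ a)).exists
  obtain ⟨C, hC⟩ := eq_const_mul_exp_of_wronskian hdiff hga (x₀ := q) hqa
    ((deriv (theta τ) q * theta τ (q - a) - theta τ q * deriv (theta τ) (q - a))
      / (theta τ q * theta τ (q - a))) (fun x => by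
        have h0 : deriv (fun x => theta τ (x - a)) x = deriv (theta τ) (x - a) :=
          deriv_comp_sub_const (f := theta τ) a x
        rw [h0, div_mul_eq_mul_div, eq_div_iff (mul_ne_zero hq hqa), hW x q]
        ring)
  generalize (deriv (theta τ) q * theta τ (q - a) - theta τ q * deriv (theta τ) (q - a))
      / (theta τ q * theta τ (q - a)) = α at hC
  -- Comparing the quasi-periods of both sides of `hC` gives exp α = 1 here and exp (α τ + 2πi a) =
  -- 1 below. Taking logarithms and eliminating α exhibits a as a lattice point.
  have hone : Complex.exp α = 1 := by
    have h := hC (q + 1)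
    rw [add_sub_right_comm, theta_add_one, theta_add_one, mul_add, mul_one, Complex.exp_add] at h
    refine mul_left_cancel₀ hq ?_
    linear_combination Complex.exp α * hC q + h
  have htau : Complex.exp (α * τ + 2 * Real.pi * Complex.I * a) = 1 := by
    have h := hC (q + τ)
    have he : Complex.exp (-(Real.pi * Complex.I * (τ + 2 * (q - a))))
        = Complex.exp (-(Real.pi * Complex.I * (τ + 2 * q)))
          * Complex.exp (2 * Real.pi * Complex.I * a) := by
      rw [← Complex.exp_add]; congr 1; ring
    rw [add_sub_right_comm, theta_add_tau, theta_add_tau, mul_add α, Complex.exp_add, he] at h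
    rw [Complex.exp_add]
    refine mul_left_cancel₀
      (mul_ne_zero (Complex.exp_ne_zero (-(Real.pi * Complex.I * (τ + 2 * q)))) hq) ?_
    linear_combination Complex.exp (-(Real.pi * Complex.I * (τ + 2 * q)))
      * Complex.exp (α * τ) * Complex.exp (2 * Real.pi * Complex.I * a) * hC q + h
  obtain ⟨k, hk⟩ := Complex.exp_eq_one_iff.mp hone
  obtain ⟨l, hl⟩ := Complex.exp_eq_one_iff.mp htau
  refine ⟨l, -k, ?_⟩
  have hpi : 2 * (Real.pi : ℂ) * Complex.I ≠ 0 := by simp [Real.pi_ne_zero]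
  refine mul_left_cancel₀ hpi ?_
  rw [hk] at hl
  push_cast
  linear_combination hl

lemma theta_ne_zero {τ : ℂ} (hτ : 0 < τ.im) {a : ℂ} (ha : a ∉ lattice τ) : theta τ a ≠ 0 :=
  fun h => ha (mem_lattice_of_theta_eq_zero hτ h)

end EllipticBethe

end

noncomputable section

namespace EllipticBethe

open Filter Topology

/-! ### Partial fractions for the theta function -/

section PartialFractions

variable {κ : Type*} [DecidableEq κ]

/-- The sum `∑_{j ∈ S} ∏_{i ∈ S} θ(x_j - y_i) / ∏_{i ≠ j} θ(x_j - x_i)`. -/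
def residueSum (τ : ℂ) (S : Finset κ) (x y : κ → ℂ) : ℂ :=
  ∑ j ∈ S, (∏ i ∈ S, theta τ (x j - y i)) / ∏ i ∈ S.erase j, theta τ (x j - x i)

/-- A zero placed on a node kills the term of that node and cancels one factor in each of the
others. -/
lemma residueSum_erase {τ : ℂ} {S : Finset κ} {x y : κ → ℂ}
    (hx : ∀ i ∈ S, ∀ j ∈ S, i ≠ j → theta τ (x i - x j) ≠ 0) {b : κ} (hb : b ∈ S)
    (hy : y b = x b) : residueSum τ S x y = residueSum τ (S.erase b) x y := by
  have h0 : ∏ i ∈ S, theta τ (x b - y i) = 0 :=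
    Finset.prod_eq_zero hb (by rw [hy, sub_self, theta_zero])
  rw [residueSum, ← Finset.add_sum_erase S _ hb, h0, zero_div, zero_add, residueSum]
  refine Finset.sum_congr rfl fun j hj => ?_
  obtain ⟨hjb, hjS⟩ := Finset.mem_erase.mp hj
  rw [← Finset.mul_prod_erase S _ hb,
    ← Finset.mul_prod_erase (S.erase j) _ (Finset.mem_erase.mpr ⟨hjb.symm, hb⟩), hy,
    Finset.erase_right_comm, mul_div_mul_left _ _ (hx j hjS b hb hjb)]

lemma sum_update_update {S : Finset κ} {a b : κ} (ha : a ∈ S) (hb : b ∈ S) (hab : a ≠ b)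
    (y : κ → ℂ) (u v : ℂ) :
    ∑ i ∈ S, Function.update (Function.update y a u) b v i
      = ∑ i ∈ S, y i - y a - y b + u + v := by
  have ha' : a ∈ S.erase b := Finset.mem_erase.mpr ⟨hab, ha⟩
  rw [← Finset.add_sum_erase S _ hb, ← Finset.add_sum_erase S y hb,
    ← Finset.add_sum_erase _ _ ha', ← Finset.add_sum_erase _ y ha']
  have : ∑ i ∈ (S.erase b).erase a, Function.update (Function.update y a u) b v i
      = ∑ i ∈ (S.erase b).erase a, y i := by
    refine Finset.sum_congr rfl fun i hi => ?_
    simp only [Finset.mem_erase] at hi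
    rw [Function.update_of_ne hi.2.1, Function.update_of_ne hi.1]
  rw [this, Function.update_self, Function.update_of_ne hab, Function.update_self]
  ring

lemma prod_theta_update_update {τ : ℂ} {S : Finset κ} {a b : κ} (ha : a ∈ S) (hb : b ∈ S)
    (hab : a ≠ b) (y : κ → ℂ) (u v X : ℂ) :
    ∏ i ∈ S, theta τ (X - Function.update (Function.update y a u) b v i)
      = theta τ (X - u) * theta τ (X - v) * ∏ i ∈ (S.erase b).erase a, theta τ (X - y i) := by
  have ha' : a ∈ S.erase b := Finset.mem_erase.mpr ⟨hab, ha⟩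
  rw [← Finset.mul_prod_erase S _ hb, ← Finset.mul_prod_erase _ _ ha']
  have : ∏ i ∈ (S.erase b).erase a, theta τ (X - Function.update (Function.update y a u) b v i)
      = ∏ i ∈ (S.erase b).erase a, theta τ (X - y i) := by
    refine Finset.prod_congr rfl fun i hi => ?_
    simp only [Finset.mem_erase] at hi
    rw [Function.update_of_ne hi.2.1, Function.update_of_ne hi.1]
  rw [this, Function.update_self, Function.update_of_ne hab, Function.update_self]
  ring

/-- As a function of X, θ(X - y_a) θ(X - y_b) is a combination, by the three-term relation, of two
such products with the same sum of zeros, one vanishing at x_b and the other at x_a. This is theta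
interpolation at two nodes. -/
lemma residueSum_update_mul {τ : ℂ} (hτ : 0 < τ.im) {S : Finset κ} (x y : κ → ℂ) {a b : κ}
    (ha : a ∈ S) (hb : b ∈ S) (hab : a ≠ b) :
    theta τ (x a + x b - (y a + y b)) * theta τ (x a - x b) * residueSum τ S x y
      = theta τ (x a - y b) * theta τ (x a - y a) * residueSum τ S x
          (Function.update (Function.update y a (y a + y b - x b)) b (x b))
        - theta τ (x b - y b) * theta τ (x b - y a) * residueSum τ S x
          (Function.update (Function.update y a (x a)) b (y a + y b - x a)) := by
  have hself : y = Function.update (Function.update y a (y a)) b (y b) := by simp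
  simp only [residueSum, Finset.mul_sum, ← Finset.sum_sub_distrib]
  refine Finset.sum_congr rfl fun j _ => ?_
  have hy := prod_theta_update_update (τ := τ) ha hb hab y (y a) (y b) (x j)
  rw [← hself] at hy
  rw [hy, prod_theta_update_update ha hb hab, prod_theta_update_update ha hb hab]
  have h := theta_three_term_of_eq hτ (a₁ := x j - y b) (a₂ := x j - y a)
    (a₃ := x a + x b - (y a + y b)) (a₄ := x a - x b) (b₁ := x j - (y a + y b - x b))
    (b₂ := x j - x b) (b₃ := x a - y b) (b₄ := x a - y a) (c₁ := x j - (y a + y b - x a))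
    (c₂ := x j - x a) (c₃ := x b - y b) (c₄ := x b - y a)
    (x j - (y a + y b) / 2) ((y a - y b) / 2) (x a - (y a + y b) / 2) (x b - (y a + y b) / 2)
  simp only [div_eq_mul_inv]
  linear_combination (∏ i ∈ (S.erase b).erase a, theta τ (x j - y i))
    * (∏ i ∈ S.erase j, theta τ (x j - x i))⁻¹ * h

/-- The partial fraction identity for the theta function. -/
lemma residueSum_eq_zero {τ : ℂ} (hτ : 0 < τ.im) {S : Finset κ} {x y : κ → ℂ}
    (hx : ∀ i ∈ S, ∀ j ∈ S, i ≠ j → theta τ (x i - x j) ≠ 0)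
    (hsum : ∑ i ∈ S, x i = ∑ i ∈ S, y i) : residueSum τ S x y = 0 := by
  induction hn : S.card using Nat.strong_induction_on generalizing S y with
  | _ n ih =>
    have herase : ∀ (z : κ → ℂ) (b : κ), b ∈ S → z b = x b → ∑ i ∈ S, x i = ∑ i ∈ S, z i →
        residueSum τ S x z = 0 := fun z b hb hz hs => by
      rw [residueSum_erase hx hb hz]
      refine ih _ (hn ▸ Finset.card_erase_lt_of_mem hb)
        (fun i hi j hj => hx i (Finset.mem_of_mem_erase hi) j (Finset.mem_of_mem_erase hj)) ?_ rfl
      rw [← Finset.add_sum_erase S _ hb, ← Finset.add_sum_erase S z hb, hz] at hs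
      exact add_left_cancel hs
    -- Both interpolating sums have a zero on a node and vanish by `herase`; division by the
    -- interpolation factor needs `hne`.
    have hstep : ∀ (z : κ → ℂ) (a b : κ), a ∈ S → b ∈ S → a ≠ b →
        theta τ (x a + x b - (z a + z b)) ≠ 0 → ∑ i ∈ S, x i = ∑ i ∈ S, z i →
        residueSum τ S x z = 0 := fun z a b ha hb hab hne hs => by
      have h := residueSum_update_mul hτ x z ha hb hab
      rw [herase _ b hb (Function.update_self ..) (by
          rw [sum_update_update ha hb hab, hs]; ring),
        herase (Function.update (Function.update z a (x a)) b (z a + z b - x a)) a ha (by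
          rw [Function.update_of_ne hab, Function.update_self]) (by
          rw [sum_update_update ha hb hab, hs]; ring), mul_zero, mul_zero, sub_zero] at h
      exact (mul_eq_zero.mp h).resolve_left (mul_ne_zero hne (hx a ha b hb hab))
    rcases S.eq_empty_or_nonempty with rfl | ⟨a, ha⟩
    · simp [residueSum]
    rcases (S.erase a).eq_empty_or_nonempty with he | ⟨b, hb'⟩
    · have hS : S = {a} := by rw [← Finset.insert_erase ha, he]; rfl
      subst hS
      simp only [Finset.sum_singleton] at hsum
      simp [residueSum, hsum]
    obtain ⟨hba, hb⟩ := Finset.mem_erase.mp hb'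
    rcases ((S.erase a).erase b).eq_empty_or_nonempty with he | ⟨c, hc'⟩
    -- With exactly two nodes the sum condition makes the interpolation factor θ(0) = 0; the two
    -- terms cancel directly, by oddness.
    · have hS : S = {a, b} := by
        rw [← Finset.insert_erase ha, ← Finset.insert_erase hb', he]; rfl
      subst hS
      have hab' : a ∉ ({b} : Finset κ) := by simpa using hba.symm
      have e1 : ({a, b} : Finset κ).erase a = {b} := Finset.erase_insert hab'
      have e2 : ({a, b} : Finset κ).erase b = {a} := by
        rw [Finset.pair_comm, Finset.erase_insert (by simpa using hba)]
      simp only [Finset.sum_insert hab', Finset.sum_singleton] at hsum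
      simp only [residueSum, Finset.sum_insert hab', Finset.prod_insert hab',
        Finset.sum_singleton, Finset.prod_singleton, e1, e2]
      rw [theta_sub_comm τ (x b) (x a), show x a - y a = -(x b - y b) by linear_combination hsum,
        show x a - y b = -(x b - y a) by linear_combination hsum, theta_neg, theta_neg, div_neg]
      ring
    simp only [Finset.mem_erase] at hc'
    obtain ⟨hcb, hca, hc⟩ := hc'
    -- A third node gives room to move y_a by e and compensate at y_c. The interpolation factor for
    -- a and b is then nonzero off a closed discrete set of e, and continuity recovers e = 0.
    let z : ℂ → κ → ℂ := fun e => Function.update (Function.update y a (y a + e)) c (y c - e)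
    have hz0 : z 0 = y := by simp [z]
    have hcont : Continuous fun e => residueSum τ S x (z e) := by
      simp only [residueSum, z, prod_theta_update_update ha hc hca.symm]
      have := (differentiable_theta hτ).continuous
      fun_prop
    have hev : (fun e => residueSum τ S x (z e)) =ᶠ[codiscrete ℂ] fun _ => 0 := by
      filter_upwards [eventually_theta_sub_ne_zero hτ (x a + x b - (y a + y b))] with e he
      refine hstep (z e) a b ha hb hba.symm ?_ ?_
      · simp only [z]
        rw [Function.update_of_ne hca.symm, Function.update_self, Function.update_of_ne hcb.symm,
          Function.update_of_ne hba, show x a + x b - (y a + e + y b)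
            = -(e - (x a + x b - (y a + y b))) by ring, theta_neg]
        exact neg_ne_zero.mpr he
      · simp only [z]
        rw [sum_update_update ha hc hca.symm, hsum]
        ring
    have := eq_of_eventuallyEq_codiscrete (x := 0) hcont.continuousAt continuousAt_const hev
    rwa [hz0] at this

/-- The partial fraction identity with two distinguished nodes. -/
lemma partial_fraction_insert {τ : ℂ} (hτ : 0 < τ.im) {K : Finset κ} {a b : κ} (haK : a ∉ K)
    (hbK : b ∉ K) (hab : a ≠ b) {x y : κ → ℂ}
    (hx : ∀ i ∈ K, ∀ j ∈ K, i ≠ j → theta τ (x i - x j) ≠ 0)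
    (hxa : ∀ j ∈ K, theta τ (x j - x a) ≠ 0) (hxb : ∀ j ∈ K, theta τ (x j - x b) ≠ 0)
    (hne : theta τ (x a - x b) ≠ 0)
    (hsum : x a + x b + ∑ i ∈ K, x i = y a + y b + ∑ i ∈ K, y i) :
    ∑ j ∈ K, theta τ (x j - y a) * theta τ (x j - y b) * (∏ i ∈ K, theta τ (x j - y i))
        / (theta τ (x j - x a) * theta τ (x j - x b) * ∏ i ∈ K.erase j, theta τ (x j - x i))
      + theta τ (x a - y a) * theta τ (x a - y b) * (∏ i ∈ K, theta τ (x a - y i))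
        / (theta τ (x a - x b) * ∏ i ∈ K, theta τ (x a - x i))
      + theta τ (x b - y a) * theta τ (x b - y b) * (∏ i ∈ K, theta τ (x b - y i))
        / (theta τ (x b - x a) * ∏ i ∈ K, theta τ (x b - x i)) = 0 := by
  have ha : a ∉ insert b K := by simp [hab, haK]
  have hcomm : ∀ {u v : ℂ}, theta τ (u - v) ≠ 0 → theta τ (v - u) ≠ 0 := fun {u v} h => by
    rw [theta_sub_comm]; exact neg_ne_zero.mpr h
  have h := residueSum_eq_zero hτ (S := insert a (insert b K)) (x := x) (y := y) (by
    intro i hi j hj hij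
    simp only [Finset.mem_insert] at hi hj
    rcases hi with rfl | rfl | hi <;> rcases hj with rfl | rfl | hj
    · exact absurd rfl hij
    · exact hne
    · exact hcomm (hxa j hj)
    · exact hcomm hne
    · exact absurd rfl hij
    · exact hcomm (hxb j hj)
    · exact hxa i hi
    · exact hxb i hi
    · exact hx i hi j hj hij) (by
    rw [Finset.sum_insert ha, Finset.sum_insert hbK, Finset.sum_insert ha, Finset.sum_insert hbK]
    linear_combination hsum)
  have e1 : (insert a (insert b K)).erase a = insert b K := Finset.erase_insert ha
  have e2 : (insert a (insert b K)).erase b = insert a K := by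
    rw [Finset.insert_comm, Finset.erase_insert (by simp [hab.symm, hbK])]
  simp only [residueSum, Finset.sum_insert ha, Finset.sum_insert hbK, e1, e2,
    Finset.prod_insert ha, Finset.prod_insert hbK, Finset.prod_insert haK] at h
  have hterm : ∀ j ∈ K, ∏ i ∈ (insert a (insert b K)).erase j, theta τ (x j - x i)
      = theta τ (x j - x a) * theta τ (x j - x b) * ∏ i ∈ K.erase j, theta τ (x j - x i) := by
    intro j hj
    have hja : j ≠ a := fun h => haK (h ▸ hj)
    have hjb : j ≠ b := fun h => hbK (h ▸ hj)
    rw [Finset.erase_insert_of_ne hja.symm, Finset.erase_insert_of_ne hjb.symm,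
      Finset.prod_insert (by simp [hab, haK]), Finset.prod_insert (by simp [hbK]), mul_assoc]
  rw [Finset.sum_congr rfl fun j hj => by rw [hterm j hj]] at h
  simp only [← mul_assoc] at h
  linear_combination h

variable {ι : Type*} [DecidableEq ι]

/-- The partial fraction identity for the function
`θ(x - p) θ(x - r) ∏_{i ∈ K} θ(x - t_i - h)` and the nodes `t_i`, `u`, `v`. -/
lemma partial_fraction_shift {τ : ℂ} (hτ : 0 < τ.im) {K : Finset ι} {t : ι → ℂ}
    {u v p r h : ℂ} (ht : ∀ i ∈ K, ∀ j ∈ K, i ≠ j → theta τ (t i - t j) ≠ 0)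
    (hu : ∀ j ∈ K, theta τ (t j - u) ≠ 0) (hv : ∀ j ∈ K, theta τ (t j - v) ≠ 0)
    (huv : theta τ (u - v) ≠ 0) (hsum : u + v = p + r + h * K.card) :
    ∑ j ∈ K, theta τ h * theta τ (t j - p) * theta τ (t j - r)
        / (theta τ (t j - u) * theta τ (t j - v))
        * ∏ i ∈ K.erase j, theta τ (t j - t i - h) / theta τ (t j - t i)
      = theta τ (u - p) * theta τ (u - r) / theta τ (u - v)
          * ∏ i ∈ K, theta τ (u - t i - h) / theta τ (u - t i)
        - theta τ (v - p) * theta τ (v - r) / theta τ (u - v)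
          * ∏ i ∈ K, theta τ (v - t i - h) / theta τ (v - t i) := by
  -- The extra nodes u and v are indexed by `none` and `some none`, the zeros being p, r and the t_i
  -- + h.
  let e : ι ↪ Option (Option ι) := Function.Embedding.some.trans Function.Embedding.some
  have key := partial_fraction_insert hτ (K := K.map e) (a := none) (b := some none)
    (x := fun o => o.elim u fun o => o.elim v t)
    (y := fun o => o.elim p fun o => o.elim r fun i => t i + h)
    (by simp [e]) (by simp [e]) (by simp)
    (by simpa [e] using ht) (by simpa [e] using hu) (by simpa [e] using hv) (by simpa using huv)
    (by
      simp only [Finset.sum_map, e, Function.Embedding.trans_apply, Function.Embedding.some_apply,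
        Option.elim_none, Option.elim_some, Finset.sum_add_distrib, Finset.sum_const,
        nsmul_eq_mul]
      linear_combination hsum)
  rw [Finset.sum_map, Finset.sum_congr rfl fun j _ => by rw [← Finset.map_erase]] at key
  simp only [Finset.prod_map, e,
    Function.Embedding.trans_apply, Function.Embedding.some_apply,
    Option.elim_none, Option.elim_some, ← sub_sub] at key
  rw [theta_sub_comm τ v u] at key
  -- The factor i = j of the numerator is θ(-h) = -θ(h); this is the origin of θ(h) in the
  -- statement.
  have hterm : ∀ j ∈ K, theta τ h * theta τ (t j - p) * theta τ (t j - r)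
        / (theta τ (t j - u) * theta τ (t j - v))
        * ∏ i ∈ K.erase j, theta τ (t j - t i - h) / theta τ (t j - t i)
      = -(theta τ (t j - p) * theta τ (t j - r) * (∏ i ∈ K, theta τ (t j - t i - h))
        / (theta τ (t j - u) * theta τ (t j - v)
          * ∏ i ∈ K.erase j, theta τ (t j - t i))) := fun j hj => by
    rw [← Finset.mul_prod_erase K _ hj, sub_self, zero_sub, theta_neg, Finset.prod_div_distrib]
    simp only [div_eq_mul_inv, mul_inv]
    ring
  rw [Finset.sum_congr rfl hterm, Finset.sum_neg_distrib, Finset.prod_div_distrib,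
    Finset.prod_div_distrib]
  simp only [div_eq_mul_inv, mul_inv, inv_neg] at key ⊢
  linear_combination -key

end PartialFractions

end EllipticBethe

end

noncomputable section

namespace EllipticBethe

open Filter Topology

/-! ### Scalar identities for the actions of b and a -/

section ExchangeIdentities

variable {ι : Type*}

lemma prod_ne_zero_theta {τ : ℂ} {K : Finset ι} {f : ι → ℂ} (h : ∀ i ∈ K, theta τ (f i) ≠ 0) :
    ∏ i ∈ K, theta τ (f i) ≠ 0 := Finset.prod_ne_zero_iff.mpr h

variable [DecidableEq ι]

/-- The identity behind the action of `b` on a tensor product. -/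
lemma raising_identity {τ : ℂ} (hτ : 0 < τ.im) {K : Finset ι} {t : ι → ℂ} {t₀ s p g ν : ℂ}
    (ht : ∀ i ∈ K, ∀ j ∈ K, i ≠ j → theta τ (t i - t j) ≠ 0)
    (ht₀ : ∀ j ∈ K, theta τ (t₀ - t j) ≠ 0) (hs : ∀ j ∈ K, theta τ (s + t j) ≠ 0)
    (hs₀ : theta τ (s + t₀) ≠ 0) (hν : ν = s + p + g * K.card) :
    (∏ i ∈ K, theta τ (s + t i + g)) * (theta τ (t₀ - p - g * K.card) * theta τ (s + p))
      + ∑ j ∈ K, theta τ (t j - p) * (theta τ (t₀ - t j - ν) * theta τ g / theta τ (t₀ - t j))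
          * theta τ (s + t₀)
          * ∏ i ∈ K.erase j, theta τ (t j - t i - g) / theta τ (t j - t i) * theta τ (s + t i)
      = theta τ ν * theta τ (t₀ - p)
          * ∏ i ∈ K, theta τ (t₀ - t i - g) / theta τ (t₀ - t i) * theta τ (s + t i) := by
  -- The nodes are t_i, t₀ and -s, and the value of ν is precisely the sum condition for them. The
  -- goal is this expansion multiplied by θ(s + t₀) ∏ θ(s + t_i).
  have key := partial_fraction_shift hτ (K := K) (t := t) (u := t₀) (v := -s) (p := p)
    (r := t₀ - ν) (h := g) ht (fun j hj => by
      rw [theta_sub_comm]; exact neg_ne_zero.mpr (ht₀ j hj))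
    (fun j hj => by rw [sub_neg_eq_add, add_comm]; exact hs j hj)
    (by rw [sub_neg_eq_add, add_comm]; exact hs₀) (by rw [hν]; ring)
  have hS := prod_ne_zero_theta hs
  have hsumj : ∀ j ∈ K, theta τ (t j - p) * (theta τ (t₀ - t j - ν) * theta τ g
        / theta τ (t₀ - t j)) * theta τ (s + t₀)
        * ∏ i ∈ K.erase j, theta τ (t j - t i - g) / theta τ (t j - t i) * theta τ (s + t i)
      = (theta τ (s + t₀) * ∏ i ∈ K, theta τ (s + t i))
        * (theta τ g * theta τ (t j - p) * theta τ (t j - (t₀ - ν))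
        / (theta τ (t j - t₀) * theta τ (t j - -s))
        * ∏ i ∈ K.erase j, theta τ (t j - t i - g) / theta τ (t j - t i)) := fun j hj => by
    have h1 := ht₀ j hj
    have h2 := hs j hj
    rw [Finset.prod_mul_distrib, ← Finset.mul_prod_erase K (fun i => theta τ (s + t i)) hj,
      theta_sub_comm τ (t j) t₀, theta_sub_comm τ (t j) (t₀ - ν), sub_neg_eq_add, add_comm (t j),
      sub_right_comm]
    field_simp
  have hlast : ∏ i ∈ K, theta τ (-s - t i - g) / theta τ (-s - t i)
      = (∏ i ∈ K, theta τ (s + t i + g)) / ∏ i ∈ K, theta τ (s + t i) := by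
    rw [← Finset.prod_div_distrib]
    refine Finset.prod_congr rfl fun i _ => ?_
    rw [show -s - t i - g = -(s + t i + g) by ring, show -s - t i = -(s + t i) by ring,
      theta_neg, theta_neg, neg_div_neg_eq]
  rw [Finset.sum_congr rfl hsumj, ← Finset.mul_sum, key, hlast, Finset.prod_mul_distrib,
    show t₀ - -s = s + t₀ by ring, show -s - p = -(s + p) by ring, theta_neg,
    show -s - (t₀ - ν) = -(t₀ - p - g * K.card) by rw [hν]; ring, theta_neg,
    show t₀ - (t₀ - ν) = ν by ring]
  field_simp
  ring

/-- Both sums are evaluated by partial fractions, the first with extra nodes t₀ and g - s, the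
second with t₀ - g and -s. The contribution of t₀ to the first matches that of -s to the second; the
rest is a three-term relation times ∏ θ(s + t_i). The hypotheses `htg` and `hs₀` keep these
auxiliary nodes separate. -/
lemma exchange_identity_of_ne {τ : ℂ} (hτ : 0 < τ.im) {K : Finset ι} {t : ι → ℂ}
    {t₀ s p q g ρ μ : ℂ}
    (ht : ∀ i ∈ K, ∀ j ∈ K, i ≠ j → theta τ (t i - t j) ≠ 0)
    (ht₀ : ∀ j ∈ K, theta τ (t₀ - t j) ≠ 0) (htg : ∀ j ∈ K, theta τ (t₀ - t j - g) ≠ 0)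
    (hs : ∀ j ∈ K, theta τ (s + t j) ≠ 0) (hsg : ∀ j ∈ K, theta τ (s + t j - g) ≠ 0)
    (hs₀ : theta τ (t₀ + s - g) ≠ 0) (hρ : ρ = s + p + g * (K.card - 1))
    (hμ : μ = s + q - g * (K.card - 1)) :
    theta τ (t₀ - q + g * (K.card - 1)) * theta τ (s + q)
        * (∑ j ∈ K, theta τ (t j - p) * (theta τ (t₀ - t j - ρ) * theta τ g / theta τ (t₀ - t j))
          * ∏ i ∈ K.erase j, theta τ (t j - t i - g) / theta τ (t j - t i) * theta τ (s + t i - g))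
        - (∏ i ∈ K, theta τ (s + t i)) * (theta τ (t₀ - p - q - s)
          * theta τ (q - p - g * (K.card - 1)) * theta τ (g * K.card))
      = theta τ ρ * theta τ (t₀ - p)
        * ∑ j ∈ K, theta τ (t j - q) * (theta τ (t₀ - t j - μ) * theta τ g / theta τ (t₀ - t j))
          * ∏ i ∈ K.erase j, theta τ (t₀ - t i - g) / theta τ (t₀ - t i)
            * (theta τ (t j - t i + g) / theta τ (t j - t i)) * theta τ (s + t i) := by
  have key1 := partial_fraction_shift hτ (K := K) (t := t) (u := t₀) (v := g - s) (p := p)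
    (r := t₀ - ρ) (h := g) ht (fun j hj => by
      rw [theta_sub_comm]; exact neg_ne_zero.mpr (ht₀ j hj))
    (fun j hj => by
      rw [show t j - (g - s) = s + t j - g by ring]; exact hsg j hj)
    (by rw [show t₀ - (g - s) = t₀ + s - g by ring]; exact hs₀) (by rw [hρ]; ring)
  have key2 := partial_fraction_shift hτ (K := K) (t := t) (u := t₀ - g) (v := -s) (p := q)
    (r := t₀ - μ) (h := -g) ht (fun j hj => by
      rw [theta_sub_comm, sub_right_comm]; exact neg_ne_zero.mpr (htg j hj))
    (fun j hj => by
      rw [show t j - -s = s + t j by ring]; exact hs j hj)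
    (by rw [show t₀ - g - -s = t₀ + s - g by ring]; exact hs₀) (by rw [hμ]; ring)
  have hS := prod_ne_zero_theta hs
  have hSg := prod_ne_zero_theta hsg
  have hT := prod_ne_zero_theta ht₀
  have hTg := prod_ne_zero_theta htg
  have hsum1 : ∀ j ∈ K, theta τ (t j - p) * (theta τ (t₀ - t j - ρ) * theta τ g
        / theta τ (t₀ - t j))
        * ∏ i ∈ K.erase j, theta τ (t j - t i - g) / theta τ (t j - t i) * theta τ (s + t i - g)
      = (∏ i ∈ K, theta τ (s + t i - g))
        * (theta τ g * theta τ (t j - p) * theta τ (t j - (t₀ - ρ))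
        / (theta τ (t j - t₀) * theta τ (t j - (g - s)))
        * ∏ i ∈ K.erase j, theta τ (t j - t i - g) / theta τ (t j - t i)) := fun j hj => by
    have h1 := ht₀ j hj
    have h2 := hsg j hj
    rw [Finset.prod_mul_distrib, ← Finset.mul_prod_erase K (fun i => theta τ (s + t i - g)) hj,
      theta_sub_comm τ (t j) t₀, theta_sub_comm τ (t j) (t₀ - ρ),
      show t j - (g - s) = s + t j - g by ring, sub_right_comm t₀]
    field_simp
  have hsum2 : ∀ j ∈ K, theta τ (t j - q) * (theta τ (t₀ - t j - μ) * theta τ g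
        / theta τ (t₀ - t j))
        * ∏ i ∈ K.erase j, theta τ (t₀ - t i - g) / theta τ (t₀ - t i)
            * (theta τ (t j - t i + g) / theta τ (t j - t i)) * theta τ (s + t i)
      = -((∏ i ∈ K, theta τ (s + t i)) * (∏ i ∈ K, theta τ (t₀ - t i - g))
          / (∏ i ∈ K, theta τ (t₀ - t i)))
        * (theta τ (-g) * theta τ (t j - q) * theta τ (t j - (t₀ - μ))
        / (theta τ (t j - (t₀ - g)) * theta τ (t j - -s))
        * ∏ i ∈ K.erase j, theta τ (t j - t i - -g) / theta τ (t j - t i)) := fun j hj => by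
    have h1 := ht₀ j hj
    have h2 := hs j hj
    have h3 := htg j hj
    have h4 := prod_ne_zero_theta fun i (hi : i ∈ K.erase j) => ht₀ i (Finset.mem_of_mem_erase hi)
    rw [Finset.prod_mul_distrib, Finset.prod_mul_distrib, Finset.prod_div_distrib,
      ← Finset.mul_prod_erase K (fun i => theta τ (s + t i)) hj,
      ← Finset.mul_prod_erase K (fun i => theta τ (t₀ - t i)) hj,
      ← Finset.mul_prod_erase K (fun i => theta τ (t₀ - t i - g)) hj,
      theta_sub_comm τ (t j) (t₀ - g), theta_sub_comm τ (t j) (t₀ - μ), theta_neg,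
      show t j - -s = s + t j by ring, sub_right_comm t₀ g, sub_right_comm t₀ μ]
    simp only [sub_neg_eq_add]
    field_simp
  have hlast1 : ∏ i ∈ K, theta τ (g - s - t i - g) / theta τ (g - s - t i)
      = (∏ i ∈ K, theta τ (s + t i)) / ∏ i ∈ K, theta τ (s + t i - g) := by
    rw [← Finset.prod_div_distrib]
    refine Finset.prod_congr rfl fun i _ => ?_
    rw [show g - s - t i - g = -(s + t i) by ring, show g - s - t i = -(s + t i - g) by ring,
      theta_neg, theta_neg, neg_div_neg_eq]
  have hlast2 : ∏ i ∈ K, theta τ (-s - t i - -g) / theta τ (-s - t i)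
      = (∏ i ∈ K, theta τ (s + t i - g)) / ∏ i ∈ K, theta τ (s + t i) := by
    rw [← Finset.prod_div_distrib]
    refine Finset.prod_congr rfl fun i _ => ?_
    rw [show -s - t i - -g = -(s + t i - g) by ring, show -s - t i = -(s + t i) by ring,
      theta_neg, theta_neg, neg_div_neg_eq]
  have hfirst2 : ∏ i ∈ K, theta τ (t₀ - g - t i - -g) / theta τ (t₀ - g - t i)
      = (∏ i ∈ K, theta τ (t₀ - t i)) / ∏ i ∈ K, theta τ (t₀ - t i - g) := by
    rw [← Finset.prod_div_distrib]
    refine Finset.prod_congr rfl fun i _ => ?_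
    rw [show t₀ - g - t i - -g = t₀ - t i by ring, sub_right_comm]
  have h3 := theta_three_term_of_eq hτ (a₁ := t₀ - p - q - s) (a₂ := t₀ + s - g)
    (a₃ := q - p - g * (K.card - 1)) (a₄ := g * K.card) (b₁ := -(p + g * K.card - t₀))
    (b₂ := t₀ - q + g * (K.card - 1)) (b₃ := -(s + p - g)) (b₄ := s + q) (c₁ := t₀ - p)
    (c₂ := t₀ - g - q) (c₃ := -ρ) (c₄ := μ - g)
    ((2 * t₀ - p - q - g) / 2) ((-p - q - 2 * s + g) / 2) ((q - p + g) / 2)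
    ((q - p + g) / 2 - g * K.card) (h11 := by rw [hρ]; ring) (h12 := by rw [hμ]; ring)
  simp only [theta_neg] at h3
  rw [Finset.sum_congr rfl hsum1, ← Finset.mul_sum, key1, Finset.sum_congr rfl hsum2,
    ← Finset.mul_sum, key2, hlast1, hlast2, hfirst2, Finset.prod_div_distrib,
    show t₀ - (g - s) = t₀ + s - g by ring, show t₀ - g - -s = t₀ + s - g by ring,
    show t₀ - (t₀ - ρ) = ρ by ring, show t₀ - g - (t₀ - μ) = μ - g by ring,
    show g - s - p = -(s + p - g) by ring, show -s - q = -(s + q) by ring,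
    show g - s - (t₀ - ρ) = p + g * K.card - t₀ by rw [hρ]; ring,
    show -s - (t₀ - μ) = -(t₀ - q + g * (K.card - 1)) by rw [hμ]; ring]
  simp only [theta_neg]
  field_simp
  linear_combination -(∏ i ∈ K, theta τ (s + t i)) * (∏ i ∈ K, theta τ (t₀ - t i)) * h3

/-- The identity behind the action of `a` on a tensor product. -/
lemma exchange_identity {τ : ℂ} (hτ : 0 < τ.im) {K : Finset ι} {t : ι → ℂ}
    {t₀ s p q g ρ μ : ℂ}
    (ht : ∀ i ∈ K, ∀ j ∈ K, i ≠ j → theta τ (t i - t j) ≠ 0)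
    (ht₀ : ∀ j ∈ K, theta τ (t₀ - t j) ≠ 0)
    (hs : ∀ j ∈ K, theta τ (s + t j) ≠ 0) (hsg : ∀ j ∈ K, theta τ (s + t j - g) ≠ 0)
    (hρ : ρ = s + p + g * (K.card - 1)) (hμ : μ = s + q - g * (K.card - 1)) :
    theta τ (t₀ - q + g * (K.card - 1)) * theta τ (s + q)
        * (∑ j ∈ K, theta τ (t j - p) * (theta τ (t₀ - t j - ρ) * theta τ g / theta τ (t₀ - t j))
          * ∏ i ∈ K.erase j, theta τ (t j - t i - g) / theta τ (t j - t i) * theta τ (s + t i - g))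
        - (∏ i ∈ K, theta τ (s + t i)) * (theta τ (t₀ - p - q - s)
          * theta τ (q - p - g * (K.card - 1)) * theta τ (g * K.card))
      = theta τ ρ * theta τ (t₀ - p)
        * ∑ j ∈ K, theta τ (t j - q) * (theta τ (t₀ - t j - μ) * theta τ g / theta τ (t₀ - t j))
          * ∏ i ∈ K.erase j, theta τ (t₀ - t i - g) / theta τ (t₀ - t i)
            * (theta τ (t j - t i + g) / theta τ (t j - t i)) * theta τ (s + t i) := by
  have hc := (differentiable_theta hτ).continuous
  -- Both sides are continuous in t₀ where the θ(t₀ - t_j) are nonzero, so the two extra genericity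
  -- conditions on t₀ can be dropped.
  refine eq_of_eventuallyEq_codiscrete (x := t₀)
    (f := fun t₀ => theta τ (t₀ - q + g * (K.card - 1)) * theta τ (s + q)
        * (∑ j ∈ K, theta τ (t j - p) * (theta τ (t₀ - t j - ρ) * theta τ g / theta τ (t₀ - t j))
          * ∏ i ∈ K.erase j, theta τ (t j - t i - g) / theta τ (t j - t i) * theta τ (s + t i - g))
        - (∏ i ∈ K, theta τ (s + t i)) * (theta τ (t₀ - p - q - s)
          * theta τ (q - p - g * (K.card - 1)) * theta τ (g * K.card)))
    (g := fun t₀ => theta τ ρ * theta τ (t₀ - p)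
        * ∑ j ∈ K, theta τ (t j - q) * (theta τ (t₀ - t j - μ) * theta τ g / theta τ (t₀ - t j))
          * ∏ i ∈ K.erase j, theta τ (t₀ - t i - g) / theta τ (t₀ - t i)
            * (theta τ (t j - t i + g) / theta τ (t j - t i)) * theta τ (s + t i)) ?_ ?_ ?_
  · refine ContinuousAt.sub (ContinuousAt.mul (by fun_prop) (tendsto_finsetSum _ fun j hj => ?_))
      (by fun_prop)
    change ContinuousAt _ _
    have := ht₀ j hj
    fun_prop (disch := assumption)
  · refine ContinuousAt.mul (by fun_prop) (tendsto_finsetSum _ fun j hj => ?_)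
    change ContinuousAt _ _
    have := ht₀ j hj
    refine ContinuousAt.mul (by fun_prop (disch := assumption))
      (tendsto_finsetProd _ fun i hi => ?_)
    have := ht₀ i (Finset.mem_of_mem_erase hi)
    change ContinuousAt _ _
    fun_prop (disch := assumption)
  · filter_upwards [K.eventually_all.mpr fun j _ => eventually_theta_sub_ne_zero hτ (t j),
      K.eventually_all.mpr fun j _ => eventually_theta_sub_ne_zero hτ (t j + g),
      eventually_theta_sub_ne_zero hτ (g - s)] with y h1 h2 h3
    exact exchange_identity_of_ne hτ ht h1 (fun j hj => by rw [sub_sub]; exact h2 j hj) hs hsg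
      (by rw [show y + s - g = y - (g - s) by ring]; exact h3) hρ hμ

end ExchangeIdentities

end EllipticBethe

end

noncomputable section

namespace EllipticBethe

/-! ### Splitting off the last tensor factor -/

/-- The linear map sending `e[1] ⊗ v_1 + e[-1] ⊗ v_{-1}` to `v_β`. -/
def componentMap {n : ℕ} (β : ℤˣ) : AuxTensorSpace n →ₗ[ℂ] TensorSpace n :=
  Finsupp.lcomapDomain (Prod.mk β) (Prod.mk_right_injective β)

/-- The matrix element `e[α] → e[β]` of the `L`-operator of the tensor product. -/
def entryMap (τ η : ℂ) {n : ℕ} (Λ z : Fin n → ℂ) (β α : ℤˣ) (w x : ℂ) :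
    TensorSpace n →ₗ[ℂ] TensorSpace n :=
  componentMap β ∘ₗ tensorL τ η Λ z w x ∘ₗ Finsupp.lmapDomain ℂ ℂ (Prod.mk α)

lemma entryOp_apply (τ η : ℂ) {n : ℕ} (Λ z : Fin n → ℂ) (β α : ℤˣ) (w : ℂ)
    (f : ℂ → TensorSpace n) (x : ℂ) :
    entryOp τ η Λ z β α w f x = entryMap τ η Λ z β α w x (f (x - 2 * η * ((α : ℤ) : ℂ))) :=
  rfl

/-- The map `v ↦ v ⊗ e_k`. -/
def snocMap {n : ℕ} (k : ℕ) : TensorSpace n →ₗ[ℂ] TensorSpace (n + 1) :=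
  Finsupp.lmapDomain ℂ ℂ fun κ : Fin n → ℕ => (Fin.snoc κ k : Fin (n + 1) → ℕ)

/-- The map `u ↦ u ⊗ e_k` on `V ⊗ W`. -/
def auxSnocMap {n : ℕ} (k : ℕ) : AuxTensorSpace n →ₗ[ℂ] AuxTensorSpace (n + 1) :=
  Finsupp.lmapDomain ℂ ℂ fun v : ℤˣ × (Fin n → ℕ) => (v.1, (Fin.snoc v.2 k : Fin (n + 1) → ℕ))

lemma snocMap_single {n : ℕ} (k : ℕ) (κ : Fin n → ℕ) (a : ℂ) :
    snocMap k (Finsupp.single κ a) = Finsupp.single (Fin.snoc κ k : Fin (n + 1) → ℕ) a :=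
  Finsupp.mapDomain_single

lemma auxSnocMap_single {n : ℕ} (k : ℕ) (v : ℤˣ × (Fin n → ℕ)) (a : ℂ) :
    auxSnocMap k (Finsupp.single v a)
      = Finsupp.single (v.1, (Fin.snoc v.2 k : Fin (n + 1) → ℕ)) a :=
  Finsupp.mapDomain_single

lemma sum_Ioi_castSucc {M : Type*} [AddCommMonoid M] {n : ℕ} (i : Fin n) (f : Fin (n + 1) → M) :
    ∑ l ∈ Finset.Ioi i.castSucc, f l = ∑ l ∈ Finset.Ioi i, f l.castSucc + f (Fin.last n) := by
  have h1 : Finset.Ioi i.castSucc = Finset.univ.filter fun l => i.castSucc < l := by ext; simp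
  have h2 : Finset.Ioi i = Finset.univ.filter fun l => i < l := by ext; simp
  rw [h1, h2, Finset.sum_filter, Finset.sum_filter, Fin.sum_univ_castSucc]
  simp [Fin.castSucc_lt_last]

lemma siteL_single (τ η : ℂ) {n : ℕ} (Λ z : Fin n → ℂ) (w x : ℂ) (k : Fin n)
    (v : ℤˣ × (Fin n → ℕ)) (a : ℂ) :
    siteL τ η Λ z w x k (Finsupp.single v a)
      = a • Finsupp.mapDomain (fun u : ℤˣ × ℕ => (u.1, Function.update v.2 k u.2))
        (vermaLBasis τ η (Λ k) (z k) w
          (x - 2 * η * ∑ l ∈ Finset.Ioi k, (Λ l - 2 * (v.2 l : ℂ))) v.1 (v.2 k)) := by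
  rw [siteL, Finsupp.linearCombination_single]

/-- The factors to the left see the last one only through its weight Λ - 2k, which shifts the
dynamical parameter. -/
lemma siteL_castSucc_auxSnocMap (τ η : ℂ) {n : ℕ} (Λ z : Fin (n + 1) → ℂ) (w x : ℂ) (k : ℕ)
    (i : Fin n) (u : AuxTensorSpace n) :
    siteL τ η Λ z w x i.castSucc (auxSnocMap k u)
      = auxSnocMap k (siteL τ η (Λ ∘ Fin.castSucc) (z ∘ Fin.castSucc) w
          (x - 2 * η * (Λ (Fin.last n) - 2 * k)) i u) := by
  induction u using Finsupp.induction_linear with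
  | zero => simp
  | add f g hf hg => simp only [map_add, hf, hg]
  | single v a =>
    rw [auxSnocMap_single, siteL_single, siteL_single, map_smul]
    congr 1
    rw [auxSnocMap, Finsupp.lmapDomain_apply, ← Finsupp.mapDomain_comp, sum_Ioi_castSucc]
    simp only [Fin.snoc_castSucc, Fin.snoc_last, Function.comp_apply]
    congr 1
    · funext u
      simp only [Function.comp_apply, Fin.snoc_update]
    · congr 1
      ring

lemma siteL_last_auxSnocMap_single (τ η : ℂ) {n : ℕ} (Λ z : Fin (n + 1) → ℂ) (w x : ℂ) (k : ℕ)
    (α : ℤˣ) (κ : Fin n → ℕ) (a : ℂ) :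
    siteL τ η Λ z w x (Fin.last n) (auxSnocMap k (Finsupp.single (α, κ) a))
      = a • Finsupp.mapDomain (fun u : ℤˣ × ℕ => (u.1, (Fin.snoc κ u.2 : Fin (n + 1) → ℕ)))
        (vermaLBasis τ η (Λ (Fin.last n)) (z (Fin.last n)) w x α k) := by
  have h0 : Finset.Ioi (Fin.last n) = ∅ := by
    ext l; simp [Fin.le_last]
  rw [auxSnocMap_single, siteL_single, h0]
  simp only [Finset.sum_empty, mul_zero, sub_zero, Fin.snoc_last, Fin.update_snoc_last]

lemma siteL_last_neg (τ η : ℂ) {n : ℕ} (Λ z : Fin (n + 1) → ℂ) (w x : ℂ) (k : ℕ)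
    (v : TensorSpace n) :
    siteL τ η Λ z w x (Fin.last n) (auxSnocMap k (Finsupp.lmapDomain ℂ ℂ (Prod.mk (-1)) v))
      = vermaB τ η (Λ (Fin.last n)) (z (Fin.last n)) w x k
          • auxSnocMap (k + 1) (Finsupp.lmapDomain ℂ ℂ (Prod.mk 1) v)
        + vermaD τ η (Λ (Fin.last n)) (z (Fin.last n)) w x k
          • auxSnocMap k (Finsupp.lmapDomain ℂ ℂ (Prod.mk (-1)) v) := by
  induction v using Finsupp.induction_linear with
  | zero => simp
  | add f g hf hg => simp only [map_add, hf, hg, smul_add]; abel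
  | single κ a =>
    simp only [Finsupp.lmapDomain_apply, Finsupp.mapDomain_single]
    rw [siteL_last_auxSnocMap_single]
    simp only [auxSnocMap_single]
    rw [vermaLBasis, if_neg (by decide), Finsupp.mapDomain_add]
    simp only [Finsupp.mapDomain_single, smul_add, Finsupp.smul_single, smul_eq_mul, mul_comm a]

lemma siteL_last_one (τ η : ℂ) {n : ℕ} (Λ z : Fin (n + 1) → ℂ) (w x : ℂ) (k : ℕ)
    (v : TensorSpace n) :
    siteL τ η Λ z w x (Fin.last n) (auxSnocMap k (Finsupp.lmapDomain ℂ ℂ (Prod.mk 1) v))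
      = vermaA τ η (Λ (Fin.last n)) (z (Fin.last n)) w x k
          • auxSnocMap k (Finsupp.lmapDomain ℂ ℂ (Prod.mk 1) v)
        + if k = 0 then 0 else vermaC τ η (Λ (Fin.last n)) (z (Fin.last n)) w x k
          • auxSnocMap (k - 1) (Finsupp.lmapDomain ℂ ℂ (Prod.mk (-1)) v) := by
  induction v using Finsupp.induction_linear with
  | zero => simp
  | add f g hf hg =>
    simp only [map_add, hf, hg, smul_add]
    split_ifs
    · abel
    · abel
  | single κ a =>
    simp only [Finsupp.lmapDomain_apply, Finsupp.mapDomain_single]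
    rw [siteL_last_auxSnocMap_single]
    simp only [auxSnocMap_single]
    rw [vermaLBasis, if_pos rfl, Finsupp.mapDomain_add]
    split_ifs
    · simp only [Finsupp.mapDomain_single, Finsupp.mapDomain_zero, add_zero, Finsupp.smul_single,
        smul_eq_mul, mul_comm a]
    · simp only [Finsupp.mapDomain_single, smul_add, Finsupp.smul_single, smul_eq_mul, mul_comm a]

lemma prod_siteL_castSucc_auxSnocMap (τ η : ℂ) {n : ℕ} (Λ z : Fin (n + 1) → ℂ) (w x : ℂ) (k : ℕ)
    (l : List (Fin n)) (u : AuxTensorSpace n) :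
    (l.map fun i => siteL τ η Λ z w x i.castSucc).prod (auxSnocMap k u)
      = auxSnocMap k ((l.map (siteL τ η (Λ ∘ Fin.castSucc) (z ∘ Fin.castSucc) w
          (x - 2 * η * (Λ (Fin.last n) - 2 * k)))).prod u) := by
  induction l with
  | nil => simp
  | cons i l ih =>
    rw [List.map_cons, List.prod_cons, List.map_cons, List.prod_cons, Module.End.mul_apply,
      Module.End.mul_apply, ih, siteL_castSucc_auxSnocMap]

lemma tensorL_succ (τ η : ℂ) {n : ℕ} (Λ z : Fin (n + 1) → ℂ) (w x : ℂ)
    (u : AuxTensorSpace (n + 1)) :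
    tensorL τ η Λ z w x u = ((List.finRange n).map fun i => siteL τ η Λ z w x i.castSucc).prod
      (siteL τ η Λ z w x (Fin.last n) u) := by
  rw [tensorL, List.finRange_succ_last, List.map_append, List.prod_append, List.map_map,
    Module.End.mul_apply]
  simp [Function.comp_def]

lemma componentMap_single {n : ℕ} (β γ : ℤˣ) (κ : Fin n → ℕ) (a : ℂ) :
    componentMap β (Finsupp.single (γ, κ) a) = if γ = β then Finsupp.single κ a else 0 := by
  ext κ'
  change Finsupp.single (γ, κ) a (β, κ') = _
  split_ifs with h
  · subst h
    simp [Finsupp.single_apply]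
  · simp [h]

lemma componentMap_auxSnocMap {n : ℕ} (β : ℤˣ) (k : ℕ) (u : AuxTensorSpace n) :
    componentMap β (auxSnocMap k u) = snocMap k (componentMap β u) := by
  induction u using Finsupp.induction_linear with
  | zero => simp
  | add f g hf hg => simp only [map_add, hf, hg]
  | single v a =>
    obtain ⟨γ, κ⟩ := v
    rw [auxSnocMap_single, componentMap_single, componentMap_single]
    split_ifs
    · rw [snocMap_single]
    · simp

/-- The action of `b` on `v ⊗ e_k`. -/
lemma entryMap_b_snocMap (τ η : ℂ) {n : ℕ} (Λ z : Fin (n + 1) → ℂ) (w x : ℂ) (k : ℕ)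
    (v : TensorSpace n) :
    entryMap τ η Λ z 1 (-1) w x (snocMap k v)
      = vermaB τ η (Λ (Fin.last n)) (z (Fin.last n)) w x k
          • snocMap (k + 1) (entryMap τ η (Λ ∘ Fin.castSucc) (z ∘ Fin.castSucc) 1 1 w
            (x - 2 * η * (Λ (Fin.last n) - 2 * (k + 1))) v)
        + vermaD τ η (Λ (Fin.last n)) (z (Fin.last n)) w x k
          • snocMap k (entryMap τ η (Λ ∘ Fin.castSucc) (z ∘ Fin.castSucc) 1 (-1) w
            (x - 2 * η * (Λ (Fin.last n) - 2 * k)) v) := by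
  have h : Finsupp.lmapDomain ℂ ℂ (Prod.mk (-1 : ℤˣ)) (snocMap k v)
      = auxSnocMap k (Finsupp.lmapDomain ℂ ℂ (Prod.mk (-1)) v) := by
    simp only [snocMap, auxSnocMap, Finsupp.lmapDomain_apply, ← Finsupp.mapDomain_comp]
    rfl
  simp only [entryMap, LinearMap.comp_apply]
  rw [h, tensorL_succ, siteL_last_neg]
  -- The last factor acts first, so in the raised term the others see the weight of `e_{k+1}`.
  simp only [map_add, map_smul, prod_siteL_castSucc_auxSnocMap, componentMap_auxSnocMap]
  push_cast
  rfl

/-- The factor θ(2kη) vanishes at k = 0, which makes the truncated index k - 1 harmless in the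
formula for a. -/
lemma vermaC_zero (τ η Λ z w x : ℂ) : vermaC τ η Λ z w x 0 = 0 := by
  simp [vermaC]

/-- The action of `a` on `v ⊗ e_k`. -/
lemma entryMap_a_snocMap (τ η : ℂ) {n : ℕ} (Λ z : Fin (n + 1) → ℂ) (w x : ℂ) (k : ℕ)
    (v : TensorSpace n) :
    entryMap τ η Λ z 1 1 w x (snocMap k v)
      = vermaA τ η (Λ (Fin.last n)) (z (Fin.last n)) w x k
          • snocMap k (entryMap τ η (Λ ∘ Fin.castSucc) (z ∘ Fin.castSucc) 1 1 w
            (x - 2 * η * (Λ (Fin.last n) - 2 * k)) v)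
        + vermaC τ η (Λ (Fin.last n)) (z (Fin.last n)) w x k
          • snocMap (k - 1) (entryMap τ η (Λ ∘ Fin.castSucc) (z ∘ Fin.castSucc) 1 (-1) w
            (x - 2 * η * (Λ (Fin.last n) - 2 * (k - 1))) v) := by
  have h : Finsupp.lmapDomain ℂ ℂ (Prod.mk (1 : ℤˣ)) (snocMap k v)
      = auxSnocMap k (Finsupp.lmapDomain ℂ ℂ (Prod.mk 1) v) := by
    simp only [snocMap, auxSnocMap, Finsupp.lmapDomain_apply, ← Finsupp.mapDomain_comp]
    rfl
  simp only [entryMap, LinearMap.comp_apply]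
  rw [h, tensorL_succ, siteL_last_one]
  split_ifs with hk
  · subst hk
    simp only [vermaC_zero, zero_smul, add_zero, map_smul, prod_siteL_castSucc_auxSnocMap,
      componentMap_auxSnocMap]
    rfl
  · simp only [map_add, map_smul, prod_siteL_castSucc_auxSnocMap, componentMap_auxSnocMap,
      Nat.cast_pred (Nat.pos_of_ne_zero hk)]
    rfl

end EllipticBethe

end

noncomputable section

namespace EllipticBethe

/-! ### Weight vectors -/

/-! ### Comparison of coefficients for one tensor factor -/

section Scalars

variable {ι : Type*}

lemma vermaA_eq (τ η Λ z w x : ℂ) (k : ℕ) :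
    vermaA τ η Λ z w x k = theta τ (w - qPar η Λ z + 2 * η * k) * theta τ (x + 2 * η * k)
      / (theta τ (w - qPar η Λ z) * theta τ x) := by
  rw [vermaA, qPar, show z - w + (Λ + 1 - 2 * k) * η = -(w - (z + η * (Λ + 1)) + 2 * η * k) by ring,
    show z - w + (Λ + 1) * η = -(w - (z + η * (Λ + 1))) by ring, theta_neg, theta_neg,
    neg_div_neg_eq, div_mul_div_comm, mul_right_comm 2]

lemma vermaB_eq (τ η Λ z w x : ℂ) (k : ℕ) :
    vermaB τ η Λ z w x k = -(theta τ (2 * η) / theta τ x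
      * (theta τ (x + w - qPar η Λ z + 2 * η * (k + 1)) / theta τ (w - qPar η Λ z))) := by
  rw [vermaB, qPar, show -x + z - w + (Λ - 1 - 2 * k) * η
      = -(x + w - (z + η * (Λ + 1)) + 2 * η * (k + 1)) by ring,
    show z - w + (Λ + 1) * η = -(w - (z + η * (Λ + 1))) by ring, theta_neg, theta_neg,
    neg_div_neg_eq, mul_comm (_ / _)]

lemma vermaC_eq (τ η Λ z w x : ℂ) (k : ℕ) :
    vermaC τ η Λ z w x k = theta τ (w - pPar η Λ z - x - 2 * η * (k - 1))
      * theta τ (2 * η * (Λ + 1 - k)) * theta τ (2 * η * k)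
      / (theta τ (w - qPar η Λ z) * theta τ x * theta τ (2 * η)) := by
  rw [vermaC, pPar, qPar, show -x - z + w + (Λ + 1 - 2 * k) * η
      = w - (z + η * (-Λ + 1)) - x - 2 * η * (k - 1) by ring,
    show z - w + (Λ + 1) * η = -(w - (z + η * (Λ + 1))) by ring, theta_neg,
    mul_right_comm 2 (Λ + 1 - (k : ℂ)), mul_right_comm 2 (k : ℂ), div_neg]
  rw [neg_mul, neg_mul, neg_neg, div_mul_div_comm, div_mul_div_comm]

lemma vermaD_eq (τ η Λ z w x : ℂ) (k : ℕ) :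
    vermaD τ η Λ z w x k = theta τ (w - pPar η Λ z - 2 * η * k) * theta τ (x - 2 * η * (Λ - k))
      / (theta τ (w - qPar η Λ z) * theta τ x) := by
  rw [vermaD, pPar, qPar, show z - w + (-Λ + 1 + 2 * k) * η
      = -(w - (z + η * (-Λ + 1)) - 2 * η * k) by ring,
    show z - w + (Λ + 1) * η = -(w - (z + η * (Λ + 1))) by ring, theta_neg, theta_neg,
    neg_div_neg_eq, div_mul_div_comm, mul_right_comm 2 (Λ - (k : ℂ))]

/-- The factor `θ(t_i - t_j - 2η) / θ(t_i - t_j)`. -/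
def pairFactor (τ η : ℂ) (t : ι → ℂ) (i j : ι) : ℂ :=
  theta τ (t i - t j - 2 * η) / theta τ (t i - t j)

/-- The part of the weight of a splitting `J ⊔ K` which does not depend on the dynamical
parameter. -/
def splitFactor (τ η Λ z : ℂ) (t : ι → ℂ) (J K : Finset ι) : ℂ :=
  (∏ i ∈ J, theta τ (t i - pPar η Λ z) / theta τ (t i - qPar η Λ z))
    * ∏ i ∈ J, ∏ j ∈ K, pairFactor τ η t i j

/-- The weight of a splitting `J ⊔ K` of the variables, those in `K` being attached to the last
tensor factor. -/
def splitWeight (τ η Λ z : ℂ) (t : ι → ℂ) (J K : Finset ι) (x : ℂ) : ℂ :=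
  splitFactor τ η Λ z t J K
    * ∏ j ∈ K, theta τ (x + t j - qPar η Λ z + 2 * η * K.card) / theta τ (t j - qPar η Λ z)

lemma pairFactor_swap (τ η : ℂ) (t : ι → ℂ) (i j : ι) :
    pairFactor τ η t i j = theta τ (t j - t i + 2 * η) / theta τ (t j - t i) := by
  rw [pairFactor, show t i - t j - 2 * η = -(t j - t i + 2 * η) by ring,
    theta_sub_comm τ (t i) (t j), theta_neg, neg_div_neg_eq]

lemma qPar_eq (η Λ z : ℂ) : qPar η Λ z = pPar η Λ z + 2 * η * Λ := by
  rw [qPar, pPar]; ring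

/-- Weights enter with x shifted by 2η and with |K| changed by one; collecting both in s lets terms
with different data share the factors θ(s + t_j). -/
lemma splitWeight_eq (τ η Λ z : ℂ) (t : ι → ℂ) (J K : Finset ι) {x s : ℂ}
    (h : x - qPar η Λ z + 2 * η * K.card = s) :
    splitWeight τ η Λ z t J K x = splitFactor τ η Λ z t J K
      * ((∏ j ∈ K, theta τ (s + t j)) / ∏ j ∈ K, theta τ (t j - qPar η Λ z)) := by
  rw [splitWeight, ← Finset.prod_div_distrib]
  congr 1
  refine Finset.prod_congr rfl fun j _ => ?_
  rw [← h]
  congr 2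
  ring

variable [DecidableEq ι]

/-- The coefficient of the term of `a(t_0)` in which `t_0` replaces `t_j`. -/
def exchangeCoeff (τ η : ℂ) (t : ι → ℂ) (i₀ : ι) (T : Finset ι) (j : ι) (x : ℂ) : ℂ :=
  theta τ (t i₀ - t j - x) * theta τ (2 * η) / (theta τ x * theta τ (t i₀ - t j))
    * ∏ i ∈ T.erase j, pairFactor τ η t i j

lemma splitFactor_insert_left (τ η Λ z : ℂ) (t : ι → ℂ) {J K : Finset ι} {i₀ : ι} (h : i₀ ∉ J) :
    splitFactor τ η Λ z t (insert i₀ J) K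
      = theta τ (t i₀ - pPar η Λ z) / theta τ (t i₀ - qPar η Λ z)
        * (∏ i ∈ K, pairFactor τ η t i₀ i) * splitFactor τ η Λ z t J K := by
  rw [splitFactor, splitFactor, Finset.prod_insert h, Finset.prod_insert h]
  ring

lemma splitFactor_insert_right (τ η Λ z : ℂ) (t : ι → ℂ) {J K : Finset ι} {i₀ : ι} (h : i₀ ∉ K) :
    splitFactor τ η Λ z t J (insert i₀ K)
      = (∏ i ∈ J, pairFactor τ η t i i₀) * splitFactor τ η Λ z t J K := by
  simp only [splitFactor, Finset.prod_insert h, Finset.prod_mul_distrib]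
  ring

lemma splitFactor_erase (τ η Λ z : ℂ) (t : ι → ℂ) {J K : Finset ι} {j : ι} (h : j ∈ K) :
    (∏ i ∈ J, pairFactor τ η t i j) * splitFactor τ η Λ z t J (K.erase j)
      = splitFactor τ η Λ z t J K := by
  rw [← splitFactor_insert_right _ _ _ _ _ (Finset.notMem_erase j K), Finset.insert_erase h]

lemma cast_card_erase {K : Finset ι} {j : ι} (h : j ∈ K) :
    ((K.erase j).card : ℂ) = K.card - 1 := by
  rw [Finset.card_erase_of_mem h, Nat.cast_pred (Finset.card_pos.mpr ⟨j, h⟩)]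

/-- This is the coefficient where t₀ joins the last factor: b acts there and the diagonal part of a
acts on the rest. The numerator of `vermaB` is itself the new factor of the weight, so no theta
identity is needed. -/
lemma splitWeight_raise_right (τ η Λ z : ℂ) (t : ι → ℂ) {J K : Finset ι} {i₀ : ι} (hK : i₀ ∉ K)
    (x : ℂ) :
    splitWeight τ η Λ z t J K (x + 2 * η) * vermaB τ η Λ z (t i₀) x K.card
        * ∏ i ∈ J, pairFactor τ η t i i₀
      = -(theta τ (2 * η) / theta τ x) * splitWeight τ η Λ z t J (insert i₀ K) x := by
  rw [splitWeight, splitWeight, splitFactor_insert_right _ _ _ _ _ hK, vermaB_eq,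
    Finset.prod_insert hK, Finset.card_insert_of_notMem hK]
  rw [Finset.prod_congr rfl fun j _ => by
    rw [show x + 2 * η + t j - qPar η Λ z + 2 * η * K.card
      = x + t j - qPar η Λ z + 2 * η * ((K.card + 1 : ℕ) : ℂ) by push_cast; ring]]
  push_cast
  ring

/-- This is the coefficient where t₀ joins the earlier factors. Either d acts on the last factor and
b on the others, or b acts on the last one while a replaces some t_j by t₀ in the others; all these
terms multiply the same vector. Their sum is evaluated by `raising_identity`. -/
lemma splitWeight_raise_left {τ : ℂ} (hτ : 0 < τ.im) (η Λ z : ℂ) (t : ι → ℂ) {J K : Finset ι}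
    {i₀ : ι} (hJ : i₀ ∉ J) (hJK : Disjoint J K)
    (ht : ∀ i ∈ K, ∀ j ∈ K, i ≠ j → theta τ (t i - t j) ≠ 0)
    (ht₀ : ∀ j ∈ K, theta τ (t i₀ - t j) ≠ 0)
    {x : ℂ} (hs : ∀ j ∈ insert i₀ K, theta τ (x - qPar η Λ z + 2 * η * K.card + t j) ≠ 0)
    (hν : theta τ (x - 2 * η * (Λ - 2 * K.card)) ≠ 0) :
    (∑ j ∈ K, splitWeight τ η Λ z t (insert j J) (K.erase j) (x + 2 * η)
        * vermaB τ η Λ z (t i₀) x (K.erase j).card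
        * exchangeCoeff τ η t i₀ (insert j J) j (x - 2 * η * (Λ - 2 * K.card)))
      + splitWeight τ η Λ z t J K (x + 2 * η) * vermaD τ η Λ z (t i₀) x K.card
        * -(theta τ (2 * η) / theta τ (x - 2 * η * (Λ - 2 * K.card)))
      = -(theta τ (2 * η) / theta τ x) * splitWeight τ η Λ z t (insert i₀ J) K x := by
  set p := pPar η Λ z with hp
  set q := qPar η Λ z with hqdef
  have hpq : q = p + 2 * η * Λ := qPar_eq η Λ z
  set s := x - q + 2 * η * K.card with hsdef
  set ν := x - 2 * η * (Λ - 2 * K.card) with hνdef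
  have hid : (∏ i ∈ K, theta τ (s + 2 * η + t i)) * (theta τ (t i₀ - p - 2 * η * K.card)
        * theta τ (s + p))
      + ∑ j ∈ K, theta τ (t j - p) * (theta τ (t i₀ - t j - ν) * theta τ (2 * η)
          / theta τ (t i₀ - t j)) * theta τ (s + t i₀)
          * ∏ i ∈ K.erase j, pairFactor τ η t j i * theta τ (s + t i)
      = theta τ ν * theta τ (t i₀ - p)
          * ∏ i ∈ K, pairFactor τ η t i₀ i * theta τ (s + t i) := by
    simp only [add_right_comm s]
    exact raising_identity hτ ht ht₀ (fun j hj => hs j (Finset.mem_insert_of_mem hj))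
      (hs i₀ (Finset.mem_insert_self _ _)) (by rw [hνdef, hsdef, hpq]; ring)
  set F := splitFactor τ η Λ z t J K with hF
  set Q := ∏ j ∈ K, theta τ (t j - q) with hQdef
  have hj : ∀ j ∈ K, splitWeight τ η Λ z t (insert j J) (K.erase j) (x + 2 * η)
        * vermaB τ η Λ z (t i₀) x (K.erase j).card * exchangeCoeff τ η t i₀ (insert j J) j ν
      = -(theta τ (2 * η) / theta τ x) * (F / (theta τ (t i₀ - q) * Q * theta τ ν))
        * (theta τ (t j - p) * (theta τ (t i₀ - t j - ν) * theta τ (2 * η) / theta τ (t i₀ - t j))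
          * theta τ (s + t i₀) * ∏ i ∈ K.erase j, pairFactor τ η t j i
            * theta τ (s + t i)) := fun j hjK => by
    have hjJ : j ∉ J := fun h => (Finset.disjoint_left.mp hJK h) hjK
    rw [splitWeight_eq (s := s) (h := by rw [cast_card_erase hjK, hsdef]; ring),
      splitFactor_insert_left _ _ _ _ _ hjJ, vermaB_eq, exchangeCoeff,
      Finset.erase_insert hjJ, ← hp, ← hqdef, cast_card_erase hjK, hF,
      ← splitFactor_erase _ _ _ _ _ hjK, hQdef,
      ← Finset.mul_prod_erase K (fun j => theta τ (t j - q)) hjK, Finset.prod_mul_distrib,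
      show x + t i₀ - q + 2 * η * (K.card - 1 + 1) = s + t i₀ by rw [hsdef]; ring]
    ring
  rw [Finset.sum_congr rfl hj, ← Finset.mul_sum,
    splitWeight_eq (s := s + 2 * η) (h := by rw [hsdef]; ring),
    splitWeight_eq (s := s) (h := rfl), splitFactor_insert_left _ _ _ _ _ hJ, vermaD_eq,
    ← hp, ← hqdef, ← hF, ← hQdef,
    show x - 2 * η * (Λ - K.card) = s + p by rw [hsdef, hpq]; ring]
  rw [Finset.prod_mul_distrib] at hid
  have hνinv : theta τ ν * (theta τ ν)⁻¹ = 1 := mul_inv_cancel₀ hν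
  linear_combination -(theta τ (2 * η) / theta τ x) * (F / (theta τ (t i₀ - q) * Q * theta τ ν))
    * hid - (theta τ (2 * η) / theta τ x) * (theta τ (t i₀ - p) / theta τ (t i₀ - q)
      * (∏ i ∈ K, pairFactor τ η t i₀ i) * F * ((∏ i ∈ K, theta τ (s + t i)) / Q)) * hνinv

/-- The diagonal coefficients of the action of `a` on a tensor product. -/
lemma splitWeight_diagonal {τ : ℂ} (hτ : 0 < τ.im) (η Λ z : ℂ) (t : ι → ℂ) {J K : Finset ι}
    {i₀ : ι} (hK : i₀ ∉ K) (hJK : Disjoint J K)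
    (ht : ∀ i ∈ K, ∀ j ∈ K, i ≠ j → theta τ (t i - t j) ≠ 0)
    (ht₀ : ∀ j ∈ K, theta τ (t i₀ - t j) ≠ 0)
    (hq : ∀ j ∈ insert i₀ K, theta τ (t j - qPar η Λ z) ≠ 0)
    {x : ℂ} (hs : ∀ j ∈ insert i₀ K, theta τ (x - qPar η Λ z + 2 * η * K.card + t j) ≠ 0)
    (hx : theta τ x ≠ 0) :
    splitWeight τ η Λ z t J K (x - 2 * η) * vermaA τ η Λ z (t i₀) x K.card
        * ∏ i ∈ J, pairFactor τ η t i i₀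
      = (∏ i ∈ J ∪ K, pairFactor τ η t i i₀) * splitWeight τ η Λ z t J K x
        + ∑ j ∈ K, exchangeCoeff τ η t i₀ (J ∪ K) j x
          * splitWeight τ η Λ z t J (insert i₀ (K.erase j)) x := by
  set q := qPar η Λ z with hqdef
  set s := x - q + 2 * η * K.card with hsdef
  have hid : (∏ i ∈ K, theta τ (s - 2 * η + t i)) * (theta τ (t i₀ - q + 2 * η * K.card)
        * theta τ (s + q))
      + ∑ j ∈ K, theta τ (t j - q) * (theta τ (t i₀ - t j - x) * -theta τ (2 * η)
          / theta τ (t i₀ - t j)) * theta τ (s + t i₀)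
          * ∏ i ∈ K.erase j, pairFactor τ η t i j * theta τ (s + t i)
      = theta τ x * theta τ (t i₀ - q)
          * ∏ i ∈ K, pairFactor τ η t i i₀ * theta τ (s + t i) := by
    -- The diagonal part of a is the same expansion with q for p and the opposite shift g = -2η.
    have := raising_identity hτ (K := K) (t := t) (t₀ := t i₀) (s := s) (p := q) (g := -(2 * η))
      (ν := x) ht ht₀ (fun j hj => hs j (Finset.mem_insert_of_mem hj))
      (hs i₀ (Finset.mem_insert_self _ _)) (by rw [hsdef]; ring)
    simp only [neg_mul, sub_neg_eq_add, theta_neg, ← sub_eq_add_neg, add_sub_right_comm s] at this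
    simp only [pairFactor_swap]
    exact this
  set F := splitFactor τ η Λ z t J K with hF
  set Q := ∏ j ∈ K, theta τ (t j - q) with hQdef
  set E := ∏ i ∈ J, pairFactor τ η t i i₀ with hE
  have hj : ∀ j ∈ K, exchangeCoeff τ η t i₀ (J ∪ K) j x
        * splitWeight τ η Λ z t J (insert i₀ (K.erase j)) x
      = -(F * E / (theta τ (t i₀ - q) * Q * theta τ x))
        * (theta τ (t j - q) * (theta τ (t i₀ - t j - x) * -theta τ (2 * η)
          / theta τ (t i₀ - t j)) * theta τ (s + t i₀)
          * ∏ i ∈ K.erase j, pairFactor τ η t i j * theta τ (s + t i)) := fun j hjK => by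
    have hjJ : j ∉ J := fun h => (Finset.disjoint_left.mp hJK h) hjK
    have hi₀ : i₀ ∉ K.erase j := fun h => hK (Finset.mem_of_mem_erase h)
    have hcard : ((insert i₀ (K.erase j)).card : ℂ) = K.card := by
      rw [Finset.card_insert_of_notMem hi₀, Nat.cast_add, cast_card_erase hjK]; simp
    have herase : (J ∪ K).erase j = J ∪ K.erase j := by
      rw [Finset.erase_union_distrib, Finset.erase_eq_of_notMem hjJ]
    have hqj : theta τ (t j - q) * (theta τ (t j - q))⁻¹ = 1 :=
      mul_inv_cancel₀ (hq j (Finset.mem_insert_of_mem hjK))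
    rw [splitWeight_eq (s := s) (h := by rw [hcard]), splitFactor_insert_right _ _ _ _ _ hi₀,
      exchangeCoeff, herase,
      Finset.prod_union (hJK.mono_right (Finset.erase_subset j K)), ← hqdef, hF,
      ← splitFactor_erase _ _ _ _ _ hjK, hQdef,
      ← Finset.mul_prod_erase K (fun j => theta τ (t j - q)) hjK, Finset.prod_mul_distrib,
      Finset.prod_insert hi₀, Finset.prod_insert hi₀, ← hE]
    generalize ∏ i ∈ J, pairFactor τ η t i j = a₁
    generalize ∏ i ∈ K.erase j, pairFactor τ η t i j = a₂
    generalize ∏ i ∈ K.erase j, theta τ (s + t i) = a₃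
    generalize ∏ i ∈ K.erase j, theta τ (t i - q) = a₄
    generalize splitFactor τ η Λ z t J (K.erase j) = a₅
    linear_combination -(a₁ * a₅ * E / (theta τ (t i₀ - q) * a₄ * theta τ x)
      * (theta τ (t i₀ - t j - x) * theta τ (2 * η)
          / theta τ (t i₀ - t j)) * theta τ (s + t i₀) * a₂ * a₃) * hqj
  rw [Finset.sum_congr rfl hj, ← Finset.mul_sum,
    splitWeight_eq (s := s - 2 * η) (h := by rw [hsdef]; ring),
    splitWeight_eq (s := s) (h := rfl), Finset.prod_union hJK, vermaA_eq,
    ← hqdef, ← hF, ← hQdef, ← hE,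
    show x + 2 * η * K.card = s + q by rw [hsdef]; ring]
  rw [Finset.prod_mul_distrib] at hid
  have hxinv : theta τ x * (theta τ x)⁻¹ = 1 := mul_inv_cancel₀ hx
  have hqinv : theta τ (t i₀ - q) * (theta τ (t i₀ - q))⁻¹ = 1 :=
    mul_inv_cancel₀ (hq i₀ (Finset.mem_insert_self _ _))
  have hone : theta τ x * theta τ (t i₀ - q) * ((theta τ x)⁻¹ * (theta τ (t i₀ - q))⁻¹) = 1 := by
    rw [mul_mul_mul_comm, hxinv, hqinv, one_mul]
  linear_combination F * E / (theta τ (t i₀ - q) * Q * theta τ x) * hid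
    + (E * (∏ i ∈ K, pairFactor τ η t i i₀) * F * ((∏ i ∈ K, theta τ (s + t i)) / Q)) * hone

/-- The off-diagonal coefficients of the action of `a` on a tensor product. -/
lemma splitWeight_exchange {τ : ℂ} (hτ : 0 < τ.im) (η Λ z : ℂ) (hη : theta τ (2 * η) ≠ 0)
    (t : ι → ℂ) {J K : Finset ι}
    {i₀ : ι} (hJ : i₀ ∉ J) (hJK : Disjoint J K)
    (ht : ∀ i ∈ K, ∀ j ∈ K, i ≠ j → theta τ (t i - t j) ≠ 0)
    (ht₀ : ∀ j ∈ K, theta τ (t i₀ - t j) ≠ 0) (hq : ∀ j ∈ K, theta τ (t j - qPar η Λ z) ≠ 0)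
    {x : ℂ} (hs : ∀ j ∈ K, theta τ (x - qPar η Λ z + 2 * η * (K.card - 1) + t j) ≠ 0)
    (hsg : ∀ j ∈ K, theta τ (x - qPar η Λ z + 2 * η * (K.card - 1) + t j - 2 * η) ≠ 0)
    (hρ : theta τ (x - 2 * η * (Λ - 2 * (K.card - 1))) ≠ 0) :
    (∑ j ∈ K, splitWeight τ η Λ z t (insert j J) (K.erase j) (x - 2 * η)
        * vermaA τ η Λ z (t i₀) x (K.erase j).card
        * exchangeCoeff τ η t i₀ (insert j J) j (x - 2 * η * (Λ - 2 * (K.card - 1))))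
      + splitWeight τ η Λ z t J K (x - 2 * η) * vermaC τ η Λ z (t i₀) x K.card
        * -(theta τ (2 * η) / theta τ (x - 2 * η * (Λ - 2 * (K.card - 1))))
      = ∑ j ∈ K, exchangeCoeff τ η t i₀ (J ∪ K) j x
          * splitWeight τ η Λ z t (insert i₀ J) (K.erase j) x := by
  set p := pPar η Λ z with hp
  set q := qPar η Λ z with hqdef
  have hpq : q = p + 2 * η * Λ := qPar_eq η Λ z
  set s := x - q + 2 * η * (K.card - 1) with hsdef
  set ρ := x - 2 * η * (Λ - 2 * (K.card - 1)) with hρdef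
  have hid : theta τ (t i₀ - q + 2 * η * (K.card - 1)) * theta τ (s + q)
        * (∑ j ∈ K, theta τ (t j - p) * (theta τ (t i₀ - t j - ρ) * theta τ (2 * η)
            / theta τ (t i₀ - t j))
          * ∏ i ∈ K.erase j, pairFactor τ η t j i * theta τ (s - 2 * η + t i))
        - (∏ i ∈ K, theta τ (s + t i)) * (theta τ (t i₀ - p - q - s)
          * theta τ (q - p - 2 * η * (K.card - 1)) * theta τ (2 * η * K.card))
      = theta τ ρ * theta τ (t i₀ - p)
        * ∑ j ∈ K, theta τ (t j - q) * (theta τ (t i₀ - t j - x) * theta τ (2 * η)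
            / theta τ (t i₀ - t j))
          * ∏ i ∈ K.erase j, pairFactor τ η t i₀ i
            * pairFactor τ η t i j * theta τ (s + t i) := by
    -- The two sums come from a ⊗ a and from the claimed answer; the isolated product is the b ⊗ c
    -- term.
    have := exchange_identity hτ (K := K) (t := t) (t₀ := t i₀) (s := s) (p := p) (q := q)
      (g := 2 * η) (ρ := ρ) (μ := x) ht ht₀ hs hsg (by rw [hρdef, hsdef, hpq]; ring)
      (by rw [hsdef]; ring)
    simp only [add_sub_right_comm s, ← pairFactor_swap τ η t] at this
    exact this
  set F := splitFactor τ η Λ z t J K with hF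
  set Q := ∏ j ∈ K, theta τ (t j - q) with hQdef
  have hj1 : ∀ j ∈ K, splitWeight τ η Λ z t (insert j J) (K.erase j) (x - 2 * η)
        * vermaA τ η Λ z (t i₀) x (K.erase j).card * exchangeCoeff τ η t i₀ (insert j J) j ρ
      = (F / (theta τ (t i₀ - q) * Q * theta τ x * theta τ ρ))
        * (theta τ (t i₀ - q + 2 * η * (K.card - 1)) * theta τ (s + q))
        * (theta τ (t j - p) * (theta τ (t i₀ - t j - ρ) * theta τ (2 * η)
            / theta τ (t i₀ - t j))
          * ∏ i ∈ K.erase j, pairFactor τ η t j i * theta τ (s - 2 * η + t i)) := fun j hjK => by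
    have hjJ : j ∉ J := fun h => (Finset.disjoint_left.mp hJK h) hjK
    rw [splitWeight_eq (s := s - 2 * η) (h := by rw [cast_card_erase hjK, hsdef]; ring),
      splitFactor_insert_left _ _ _ _ _ hjJ, vermaA_eq, exchangeCoeff,
      Finset.erase_insert hjJ, ← hp, ← hqdef, cast_card_erase hjK, hF,
      ← splitFactor_erase _ _ _ _ _ hjK, hQdef,
      ← Finset.mul_prod_erase K (fun j => theta τ (t j - q)) hjK, Finset.prod_mul_distrib,
      show x + 2 * η * (K.card - 1) = s + q by rw [hsdef]; ring]
    ring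
  have hj2 : ∀ j ∈ K, exchangeCoeff τ η t i₀ (J ∪ K) j x
        * splitWeight τ η Λ z t (insert i₀ J) (K.erase j) x
      = (F / (theta τ (t i₀ - q) * Q * theta τ x)) * theta τ (t i₀ - p)
        * (theta τ (t j - q) * (theta τ (t i₀ - t j - x) * theta τ (2 * η)
            / theta τ (t i₀ - t j))
          * ∏ i ∈ K.erase j, pairFactor τ η t i₀ i
            * pairFactor τ η t i j * theta τ (s + t i)) := fun j hjK => by
    have hjJ : j ∉ J := fun h => (Finset.disjoint_left.mp hJK h) hjK
    have herase : (J ∪ K).erase j = J ∪ K.erase j := by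
      rw [Finset.erase_union_distrib, Finset.erase_eq_of_notMem hjJ]
    have hqj : theta τ (t j - q) * (theta τ (t j - q))⁻¹ = 1 := mul_inv_cancel₀ (hq j hjK)
    rw [splitWeight_eq (s := s) (h := by rw [cast_card_erase hjK]),
      splitFactor_insert_left _ _ _ _ _ hJ, exchangeCoeff, herase,
      Finset.prod_union (hJK.mono_right (Finset.erase_subset j K)), ← hp, ← hqdef, hF,
      ← splitFactor_erase _ _ _ _ _ hjK, hQdef,
      ← Finset.mul_prod_erase K (fun j => theta τ (t j - q)) hjK, Finset.prod_mul_distrib,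
      Finset.prod_mul_distrib]
    generalize ∏ i ∈ J, pairFactor τ η t i j = a₁
    generalize ∏ i ∈ K.erase j, pairFactor τ η t i j = a₂
    generalize ∏ i ∈ K.erase j, theta τ (s + t i) = a₃
    generalize ∏ i ∈ K.erase j, theta τ (t i - q) = a₄
    generalize splitFactor τ η Λ z t J (K.erase j) = a₅
    generalize ∏ i ∈ K.erase j, pairFactor τ η t i₀ i = a₆
    linear_combination -(a₁ * a₅ / (theta τ (t i₀ - q) * a₄ * theta τ x) * theta τ (t i₀ - p)
      * (theta τ (t i₀ - t j - x) * theta τ (2 * η) / theta τ (t i₀ - t j))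
      * a₆ * a₂ * a₃) * hqj
  rw [Finset.sum_congr rfl hj1, ← Finset.mul_sum, Finset.sum_congr rfl hj2, ← Finset.mul_sum,
    splitWeight_eq (s := s) (h := by rw [hsdef]; ring), vermaC_eq, ← hp, ← hqdef, ← hF, ← hQdef,
    show t i₀ - p - x - 2 * η * (K.card - 1) = t i₀ - p - q - s by rw [hsdef]; ring,
    show 2 * η * (Λ + 1 - K.card) = q - p - 2 * η * (K.card - 1) by rw [hpq]; ring]
  have hρinv : theta τ ρ * (theta τ ρ)⁻¹ = 1 := mul_inv_cancel₀ hρ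
  have hηinv : theta τ (2 * η) * (theta τ (2 * η))⁻¹ = 1 := mul_inv_cancel₀ hη
  generalize (∑ j ∈ K, theta τ (t j - p) * (theta τ (t i₀ - t j - ρ) * theta τ (2 * η)
    / theta τ (t i₀ - t j)) * ∏ i ∈ K.erase j, pairFactor τ η t j i
      * theta τ (s - 2 * η + t i)) = S₁ at hid ⊢
  generalize (∑ j ∈ K, theta τ (t j - q) * (theta τ (t i₀ - t j - x) * theta τ (2 * η)
    / theta τ (t i₀ - t j)) * ∏ i ∈ K.erase j, pairFactor τ η t i₀ i
      * pairFactor τ η t i j * theta τ (s + t i)) = S₂ at hid ⊢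
  linear_combination F / (theta τ (t i₀ - q) * Q * theta τ x * theta τ ρ) * hid
    + F / (theta τ (t i₀ - q) * Q * theta τ x) * theta τ (t i₀ - p) * S₂ * hρinv
    - F / (theta τ (t i₀ - q) * Q * theta τ x * theta τ ρ) * ((∏ i ∈ K, theta τ (s + t i))
      * (theta τ (t i₀ - p - q - s) * theta τ (q - p - 2 * η * (K.card - 1))
        * theta τ (2 * η * K.card))) * hηinv

end Scalars

end EllipticBethe

end

noncomputable section

namespace EllipticBethe

open Filter Topology

/-! ### The action of b and a on the weight vectors -/

section WeightVectors

variable {ι : Type*} [DecidableEq ι]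

/-- Reindexing by K ↦ K ∪ {j}: it gathers the terms in which t₀ replaces t_j among the earlier
factors under the set K ∪ {j}. -/
lemma sum_powerset_sdiff {M : Type*} [AddCommMonoid M] (T : Finset ι) (F : Finset ι → ι → M) :
    ∑ K ∈ T.powerset, ∑ j ∈ T \ K, F K j = ∑ K ∈ T.powerset, ∑ j ∈ K, F (K.erase j) j := by
  rw [Finset.sum_sigma', Finset.sum_sigma']
  refine Finset.sum_bij' (fun a _ => ⟨insert a.2 a.1, a.2⟩) (fun a _ => ⟨a.1.erase a.2, a.2⟩)
    ?_ ?_ ?_ ?_ ?_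
  · rintro ⟨K, j⟩ h
    simp only [Finset.mem_sigma, Finset.mem_powerset, Finset.mem_sdiff] at h ⊢
    exact ⟨Finset.insert_subset h.2.1 h.1, Finset.mem_insert_self _ _⟩
  · rintro ⟨K, j⟩ h
    simp only [Finset.mem_sigma, Finset.mem_powerset, Finset.mem_sdiff] at h ⊢
    exact ⟨(Finset.erase_subset _ _).trans h.1, h.1 h.2, Finset.notMem_erase _ _⟩
  · rintro ⟨K, j⟩ h
    simp only [Finset.mem_sigma, Finset.mem_powerset, Finset.mem_sdiff] at h
    simp [Finset.erase_insert h.2.2]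
  · rintro ⟨K, j⟩ h
    simp only [Finset.mem_sigma] at h
    simp [Finset.insert_erase h.2]
  · rintro ⟨K, j⟩ h
    simp only [Finset.mem_sigma, Finset.mem_powerset, Finset.mem_sdiff] at h
    simp [Finset.erase_insert h.2.2]

lemma sum_powerset_erase {M : Type*} [AddCommMonoid M] (T : Finset ι) (F : ι → Finset ι → M) :
    ∑ j ∈ T, ∑ K ∈ (T.erase j).powerset, F j K
      = ∑ K ∈ T.powerset, ∑ j ∈ K, F j (K.erase j) := by
  rw [← sum_powerset_sdiff T fun K j => F j K]
  refine Finset.sum_comm' fun j K => ?_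
  simp only [Finset.mem_powerset, Finset.mem_sdiff, Finset.subset_erase]
  tauto

/-- The sum over partitions in the formula for the Bethe vector, for a set `T` of variables,
defined by recursion on the number of tensor factors. -/
def weightVector (τ η : ℂ) (t : ι → ℂ) :
    (n : ℕ) → (Fin n → ℂ) → (Fin n → ℂ) → Finset ι → ℂ → TensorSpace n
  | 0, _, _, T, _ => if T = ∅ then Finsupp.single Fin.elim0 1 else 0
  | n + 1, Λ, z, T, x => ∑ K ∈ T.powerset,
      splitWeight τ η (Λ (Fin.last n)) (z (Fin.last n)) t (T \ K) K x
        • snocMap K.card (weightVector τ η t n (Λ ∘ Fin.castSucc) (z ∘ Fin.castSucc) (T \ K)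
          (x - 2 * η * (Λ (Fin.last n) - 2 * K.card)))

lemma weightVector_succ (τ η : ℂ) (t : ι → ℂ) {n : ℕ} (Λ z : Fin (n + 1) → ℂ) (T : Finset ι)
    (x : ℂ) :
    weightVector τ η t (n + 1) Λ z T x = ∑ K ∈ T.powerset,
      splitWeight τ η (Λ (Fin.last n)) (z (Fin.last n)) t (T \ K) K x
        • snocMap K.card (weightVector τ η t n (Λ ∘ Fin.castSucc) (z ∘ Fin.castSucc) (T \ K)
          (x - 2 * η * (Λ (Fin.last n) - 2 * K.card))) := rfl

lemma entryMap_zero_same (τ η : ℂ) (Λ z : Fin 0 → ℂ) (α : ℤˣ) (w x : ℂ) (v : TensorSpace 0) :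
    entryMap τ η Λ z α α w x v = v := by
  induction v using Finsupp.induction_linear with
  | zero => simp
  | add f g hf hg => simp only [map_add, hf, hg]
  | single κ a =>
    simp only [entryMap, LinearMap.comp_apply, Finsupp.lmapDomain_apply, Finsupp.mapDomain_single,
      tensorL, List.finRange_zero, List.map_nil, List.prod_nil, Module.End.one_apply]
    rw [componentMap_single, if_pos rfl]

lemma entryMap_zero_ne (τ η : ℂ) (Λ z : Fin 0 → ℂ) {α β : ℤˣ} (h : α ≠ β) (w x : ℂ)
    (v : TensorSpace 0) : entryMap τ η Λ z β α w x v = 0 := by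
  induction v using Finsupp.induction_linear with
  | zero => simp
  | add f g hf hg => simp only [map_add, hf, hg, add_zero]
  | single κ a =>
    simp only [entryMap, LinearMap.comp_apply, Finsupp.lmapDomain_apply, Finsupp.mapDomain_single,
      tensorL, List.finRange_zero, List.map_nil, List.prod_nil, Module.End.one_apply]
    rw [componentMap_single, if_neg h]

/-- The assertion that `b(t_0)` adds the variable `t_0` to the weight vector. -/
def RaisesAt (τ η : ℂ) (t : ι → ℂ) {n : ℕ} (Λ z : Fin n → ℂ) (i₀ : ι) (T : Finset ι) (x : ℂ) :
    Prop :=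
  entryMap τ η Λ z 1 (-1) (t i₀) x (weightVector τ η t n Λ z T (x + 2 * η))
    = -(theta τ (2 * η) / theta τ x) • weightVector τ η t n Λ z (insert i₀ T) x

/-- The formula for the action of `a(t_0)` on the weight vector. -/
def ExchangesAt (τ η : ℂ) (t : ι → ℂ) {n : ℕ} (Λ z : Fin n → ℂ) (i₀ : ι) (T : Finset ι) (x : ℂ) :
    Prop :=
  entryMap τ η Λ z 1 1 (t i₀) x (weightVector τ η t n Λ z T (x - 2 * η))
    = (∏ i ∈ T, pairFactor τ η t i i₀) • weightVector τ η t n Λ z T x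
      + ∑ j ∈ T, exchangeCoeff τ η t i₀ T j x
        • weightVector τ η t n Λ z (insert i₀ (T.erase j)) x

/-- After expanding by the induction hypotheses, the terms are sorted by the subset attached to the
last factor. Subsets containing t₀ are settled by `splitWeight_raise_right`, the others by
`splitWeight_raise_left`. -/
lemma raisesAt_succ {τ : ℂ} (hτ : 0 < τ.im) (η : ℂ) (t : ι → ℂ) {n : ℕ} (Λ z : Fin (n + 1) → ℂ)
    {i₀ : ι} {T : Finset ι} (hi₀ : i₀ ∉ T)
    (ht : ∀ i ∈ T, ∀ j ∈ T, i ≠ j → theta τ (t i - t j) ≠ 0)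
    (ht₀ : ∀ j ∈ T, theta τ (t i₀ - t j) ≠ 0) {x : ℂ}
    (hs : ∀ K ∈ T.powerset, ∀ j ∈ insert i₀ T, theta τ
      (x - qPar η (Λ (Fin.last n)) (z (Fin.last n)) + 2 * η * K.card + t j) ≠ 0)
    (hν : ∀ K ∈ T.powerset, theta τ (x - 2 * η * (Λ (Fin.last n) - 2 * K.card)) ≠ 0)
    (hB : ∀ K ∈ T.powerset, RaisesAt τ η t (Λ ∘ Fin.castSucc) (z ∘ Fin.castSucc) i₀ (T \ K)
      (x - 2 * η * (Λ (Fin.last n) - 2 * K.card)))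
    (hA : ∀ K ∈ T.powerset, ExchangesAt τ η t (Λ ∘ Fin.castSucc) (z ∘ Fin.castSucc) i₀ (T \ K)
      (x - 2 * η * (Λ (Fin.last n) - 2 * (K.card + 1)))) :
    RaisesAt τ η t Λ z i₀ T x := by
  set Λ₀ := Λ (Fin.last n) with hΛ₀
  set z₀ := z (Fin.last n) with hz₀
  set Ψ : Finset ι → ℂ → TensorSpace n :=
    weightVector τ η t n (Λ ∘ Fin.castSucc) (z ∘ Fin.castSucc) with hΨ
  -- Keeping y opaque makes the shifted dynamical parameter an atom for rewriting.
  obtain ⟨y, hy⟩ : ∃ y : ℂ → ℂ, ∀ k, y k = x - 2 * η * (Λ₀ - 2 * k) := ⟨_, fun _ => rfl⟩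
  have hW : ∀ S x', weightVector τ η t (n + 1) Λ z S x' = ∑ K ∈ S.powerset,
      splitWeight τ η Λ₀ z₀ t (S \ K) K x'
        • snocMap K.card (Ψ (S \ K) (x' - 2 * η * (Λ₀ - 2 * K.card))) := fun _ _ => rfl
  have hWx : ∀ S, weightVector τ η t (n + 1) Λ z S x = ∑ K ∈ S.powerset,
      splitWeight τ η Λ₀ z₀ t (S \ K) K x • snocMap K.card (Ψ (S \ K) (y K.card)) := fun S => by
    simp only [hW, hy]
  have hterm : ∀ K ∈ T.powerset, entryMap τ η Λ z 1 (-1) (t i₀) x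
      (splitWeight τ η Λ₀ z₀ t (T \ K) K (x + 2 * η)
        • snocMap K.card (Ψ (T \ K) (x + 2 * η - 2 * η * (Λ₀ - 2 * K.card))))
      = (splitWeight τ η Λ₀ z₀ t (T \ K) K (x + 2 * η) * vermaB τ η Λ₀ z₀ (t i₀) x K.card
          * ∏ i ∈ T \ K, pairFactor τ η t i i₀)
          • snocMap (K.card + 1) (Ψ (T \ K) (y (K.card + 1)))
        + (∑ j ∈ T \ K, (splitWeight τ η Λ₀ z₀ t (T \ K) K (x + 2 * η)
            * vermaB τ η Λ₀ z₀ (t i₀) x K.card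
            * exchangeCoeff τ η t i₀ (T \ K) j (y (K.card + 1)))
          • snocMap (K.card + 1) (Ψ (insert i₀ ((T \ K).erase j)) (y (K.card + 1))))
        + (splitWeight τ η Λ₀ z₀ t (T \ K) K (x + 2 * η) * vermaD τ η Λ₀ z₀ (t i₀) x K.card
          * -(theta τ (2 * η) / theta τ (y K.card)))
          • snocMap K.card (Ψ (insert i₀ (T \ K)) (y K.card)) := by
    intro K hK
    have h1 := hA K hK
    have h2 := hB K hK
    rw [ExchangesAt, ← hΨ] at h1
    rw [RaisesAt, ← hΨ] at h2
    -- The one argument of Ψ must be read as y(k + 1) - 2η for the action of a and as y(k) + 2η for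
    -- that of b.
    have e1 : x + 2 * η - 2 * η * (Λ₀ - 2 * K.card)
        = x - 2 * η * (Λ₀ - 2 * (K.card + 1)) - 2 * η := by ring
    have e2 : x - 2 * η * (Λ₀ - 2 * (K.card + 1)) - 2 * η
        = x - 2 * η * (Λ₀ - 2 * K.card) + 2 * η := by ring
    rw [map_smul, entryMap_b_snocMap, ← hΛ₀, ← hz₀, e1, h1, e2, h2, ← hy, ← hy]
    simp only [map_add, map_smul, map_sum, smul_add, Finset.smul_sum, smul_smul, mul_assoc]
  rw [RaisesAt, hW, hWx, map_sum, Finset.sum_congr rfl hterm,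
    Finset.sum_add_distrib, Finset.sum_add_distrib,
    sum_powerset_sdiff T fun K j => (splitWeight τ η Λ₀ z₀ t (T \ K) K (x + 2 * η)
            * vermaB τ η Λ₀ z₀ (t i₀) x K.card
            * exchangeCoeff τ η t i₀ (T \ K) j (y (K.card + 1)))
          • snocMap (K.card + 1) (Ψ (insert i₀ ((T \ K).erase j)) (y (K.card + 1))),
    Finset.sum_powerset_insert hi₀, smul_add, add_assoc, ← Finset.sum_add_distrib,
    Finset.smul_sum, Finset.smul_sum]
  -- On the left the terms with t₀ on the last factor come first, on the right those without it, so
  -- the halves match crosswise.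
  have hadd : ∀ u₁ u₂ v₁ v₂ : TensorSpace (n + 1), u₂ = v₁ → u₁ = v₂ → u₁ + u₂ = v₁ + v₂ :=
    fun u₁ u₂ v₁ v₂ h h' => by subst h h'; exact add_comm _ _
  refine hadd _ _ _ _ ?_ ?_
  · refine Finset.sum_congr rfl fun K hK => ?_
    have hKT := Finset.mem_powerset.mp hK
    have hiK : i₀ ∉ K := fun h => hi₀ (hKT h)
    have hinner : ∀ j ∈ K, (splitWeight τ η Λ₀ z₀ t (T \ K.erase j) (K.erase j) (x + 2 * η)
            * vermaB τ η Λ₀ z₀ (t i₀) x (K.erase j).card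
            * exchangeCoeff τ η t i₀ (T \ K.erase j) j (y ((K.erase j).card + 1)))
          • snocMap ((K.erase j).card + 1)
            (Ψ (insert i₀ ((T \ K.erase j).erase j)) (y ((K.erase j).card + 1)))
        = (splitWeight τ η Λ₀ z₀ t (insert j (T \ K)) (K.erase j) (x + 2 * η)
            * vermaB τ η Λ₀ z₀ (t i₀) x (K.erase j).card
            * exchangeCoeff τ η t i₀ (insert j (T \ K)) j (y K.card))
          • snocMap K.card (Ψ (insert i₀ (T \ K)) (y K.card)) := by
      intro j hj
      have e1 : T \ K.erase j = insert j (T \ K) := by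
        rw [Finset.sdiff_erase (hKT hj)]
      have e2 : (insert j (T \ K)).erase j = T \ K :=
        Finset.erase_insert fun h => (Finset.mem_sdiff.mp h).2 hj
      rw [e1, e2, Finset.card_erase_add_one hj, cast_card_erase hj, sub_add_cancel]
    rw [Finset.sum_congr rfl hinner, ← Finset.sum_smul, ← add_smul,
      Finset.insert_sdiff_of_notMem _ hiK, smul_smul]
    congr 1
    rw [hy]
    exact splitWeight_raise_left hτ η Λ₀ z₀ t (fun h => hi₀ (Finset.mem_sdiff.mp h).1)
      Finset.sdiff_disjoint (fun i hi j hj => ht i (hKT hi) j (hKT hj)) (fun j hj => ht₀ j (hKT hj))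
      (fun j hj => hs K hK j (Finset.insert_subset_insert i₀ hKT hj)) (hν K hK)
  · refine Finset.sum_congr rfl fun K hK => ?_
    have hKT := Finset.mem_powerset.mp hK
    have hiK : i₀ ∉ K := fun h => hi₀ (hKT h)
    have e : insert i₀ T \ insert i₀ K = T \ K := by
      rw [Finset.insert_sdiff_insert, Finset.sdiff_insert_of_notMem hi₀]
    rw [e, smul_smul, ← splitWeight_raise_right τ η Λ₀ z₀ t hiK x,
      Finset.card_insert_of_notMem hiK, Nat.cast_add_one]

/-- For each K ⊆ T two vectors occur: Ψ_{T \ K} ⊗ e_{|K|}, settled by `splitWeight_diagonal`, and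
Ψ_{{t₀} ∪ (T \ K)} ⊗ e_{|K| - 1}, settled by `splitWeight_exchange`. For empty K the second
coefficient is zero. -/
lemma exchangesAt_succ {τ : ℂ} (hτ : 0 < τ.im) (η : ℂ) (hη : theta τ (2 * η) ≠ 0) (t : ι → ℂ)
    {n : ℕ} (Λ z : Fin (n + 1) → ℂ) {i₀ : ι} {T : Finset ι} (hi₀ : i₀ ∉ T)
    (ht : ∀ i ∈ T, ∀ j ∈ T, i ≠ j → theta τ (t i - t j) ≠ 0)
    (ht₀ : ∀ j ∈ T, theta τ (t i₀ - t j) ≠ 0)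
    (hq : ∀ j ∈ insert i₀ T, theta τ (t j - qPar η (Λ (Fin.last n)) (z (Fin.last n))) ≠ 0)
    {x : ℂ} (hx : theta τ x ≠ 0)
    (hs : ∀ K ∈ T.powerset, ∀ j ∈ insert i₀ T, theta τ
      (x - qPar η (Λ (Fin.last n)) (z (Fin.last n)) + 2 * η * K.card + t j) ≠ 0)
    (hs1 : ∀ K ∈ T.powerset, ∀ j ∈ insert i₀ T, theta τ
      (x - qPar η (Λ (Fin.last n)) (z (Fin.last n)) + 2 * η * (K.card - 1) + t j) ≠ 0)
    (hs2 : ∀ K ∈ T.powerset, ∀ j ∈ insert i₀ T, theta τ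
      (x - qPar η (Λ (Fin.last n)) (z (Fin.last n)) + 2 * η * (K.card - 1) + t j - 2 * η) ≠ 0)
    (hν : ∀ K ∈ T.powerset, theta τ (x - 2 * η * (Λ (Fin.last n) - 2 * (K.card - 1))) ≠ 0)
    (hB : ∀ K ∈ T.powerset, RaisesAt τ η t (Λ ∘ Fin.castSucc) (z ∘ Fin.castSucc) i₀ (T \ K)
      (x - 2 * η * (Λ (Fin.last n) - 2 * (K.card - 1))))
    (hA : ∀ K ∈ T.powerset, ExchangesAt τ η t (Λ ∘ Fin.castSucc) (z ∘ Fin.castSucc) i₀ (T \ K)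
      (x - 2 * η * (Λ (Fin.last n) - 2 * K.card))) :
    ExchangesAt τ η t Λ z i₀ T x := by
  set Λ₀ := Λ (Fin.last n) with hΛ₀
  set z₀ := z (Fin.last n) with hz₀
  set Ψ : Finset ι → ℂ → TensorSpace n :=
    weightVector τ η t n (Λ ∘ Fin.castSucc) (z ∘ Fin.castSucc) with hΨ
  obtain ⟨y, hy⟩ : ∃ y : ℂ → ℂ, ∀ k, y k = x - 2 * η * (Λ₀ - 2 * k) := ⟨_, fun _ => rfl⟩
  have hW : ∀ S x', weightVector τ η t (n + 1) Λ z S x' = ∑ K ∈ S.powerset,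
      splitWeight τ η Λ₀ z₀ t (S \ K) K x'
        • snocMap K.card (Ψ (S \ K) (x' - 2 * η * (Λ₀ - 2 * K.card))) := fun _ _ => rfl
  have hWx : ∀ S, weightVector τ η t (n + 1) Λ z S x = ∑ K ∈ S.powerset,
      splitWeight τ η Λ₀ z₀ t (S \ K) K x • snocMap K.card (Ψ (S \ K) (y K.card)) := fun S => by
    simp only [hW, hy]
  have hterm : ∀ K ∈ T.powerset, entryMap τ η Λ z 1 1 (t i₀) x
      (splitWeight τ η Λ₀ z₀ t (T \ K) K (x - 2 * η)
        • snocMap K.card (Ψ (T \ K) (x - 2 * η - 2 * η * (Λ₀ - 2 * K.card))))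
      = (splitWeight τ η Λ₀ z₀ t (T \ K) K (x - 2 * η) * vermaA τ η Λ₀ z₀ (t i₀) x K.card
          * ∏ i ∈ T \ K, pairFactor τ η t i i₀)
          • snocMap K.card (Ψ (T \ K) (y K.card))
        + (∑ j ∈ T \ K, (splitWeight τ η Λ₀ z₀ t (T \ K) K (x - 2 * η)
            * vermaA τ η Λ₀ z₀ (t i₀) x K.card
            * exchangeCoeff τ η t i₀ (T \ K) j (y K.card))
          • snocMap K.card (Ψ (insert i₀ ((T \ K).erase j)) (y K.card)))
        + (splitWeight τ η Λ₀ z₀ t (T \ K) K (x - 2 * η) * vermaC τ η Λ₀ z₀ (t i₀) x K.card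
          * -(theta τ (2 * η) / theta τ (y (K.card - 1))))
          • snocMap (K.card - 1) (Ψ (insert i₀ (T \ K)) (y (K.card - 1))) := by
    intro K hK
    have h1 := hA K hK
    have h2 := hB K hK
    rw [ExchangesAt, ← hΨ] at h1
    rw [RaisesAt, ← hΨ] at h2
    have e1 : x - 2 * η - 2 * η * (Λ₀ - 2 * K.card)
        = x - 2 * η * (Λ₀ - 2 * K.card) - 2 * η := by ring
    have e2 : x - 2 * η * (Λ₀ - 2 * K.card) - 2 * η
        = x - 2 * η * (Λ₀ - 2 * (K.card - 1)) + 2 * η := by ring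
    rw [map_smul, entryMap_a_snocMap, ← hΛ₀, ← hz₀, e1, h1, e2, h2, ← hy, ← hy]
    simp only [map_add, map_smul, map_sum, smul_add, Finset.smul_sum, smul_smul, mul_assoc]
  have hR : ∀ j ∈ T, exchangeCoeff τ η t i₀ T j x
        • weightVector τ η t (n + 1) Λ z (insert i₀ (T.erase j)) x
      = ∑ K ∈ (T.erase j).powerset, ((exchangeCoeff τ η t i₀ T j x
          * splitWeight τ η Λ₀ z₀ t (insert i₀ (T.erase j \ K)) K x)
          • snocMap K.card (Ψ (insert i₀ (T.erase j \ K)) (y K.card))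
        + (exchangeCoeff τ η t i₀ T j x
          * splitWeight τ η Λ₀ z₀ t (T.erase j \ K) (insert i₀ K) x)
          • snocMap (insert i₀ K).card (Ψ (T.erase j \ K) (y (insert i₀ K).card))) := by
    intro j _
    have hi₀j : i₀ ∉ T.erase j := fun h => hi₀ (Finset.mem_of_mem_erase h)
    rw [hWx, Finset.sum_powerset_insert hi₀j, ← Finset.sum_add_distrib,
      Finset.smul_sum]
    refine Finset.sum_congr rfl fun K hK => ?_
    have hiK : i₀ ∉ K := fun h => hi₀j (Finset.mem_powerset.mp hK h)
    rw [Finset.insert_sdiff_insert, Finset.sdiff_insert_of_notMem hi₀j,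
      Finset.insert_sdiff_of_notMem _ hiK, smul_add, smul_smul, smul_smul]
  rw [ExchangesAt, Finset.sum_congr rfl hR, sum_powerset_erase T fun j K =>
      ((exchangeCoeff τ η t i₀ T j x
          * splitWeight τ η Λ₀ z₀ t (insert i₀ (T.erase j \ K)) K x)
          • snocMap K.card (Ψ (insert i₀ (T.erase j \ K)) (y K.card))
        + (exchangeCoeff τ η t i₀ T j x
          * splitWeight τ η Λ₀ z₀ t (T.erase j \ K) (insert i₀ K) x)
          • snocMap (insert i₀ K).card (Ψ (T.erase j \ K) (y (insert i₀ K).card))),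
    hW, hWx, map_sum, Finset.sum_congr rfl hterm,
    Finset.sum_add_distrib, Finset.sum_add_distrib,
    sum_powerset_sdiff T fun K j => (splitWeight τ η Λ₀ z₀ t (T \ K) K (x - 2 * η)
            * vermaA τ η Λ₀ z₀ (t i₀) x K.card
            * exchangeCoeff τ η t i₀ (T \ K) j (y K.card))
          • snocMap K.card (Ψ (insert i₀ ((T \ K).erase j)) (y K.card)),
    ← Finset.sum_add_distrib, ← Finset.sum_add_distrib, Finset.smul_sum,
    ← Finset.sum_add_distrib]
  refine Finset.sum_congr rfl fun K hK => ?_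
  have hKT := Finset.mem_powerset.mp hK
  have hiK : i₀ ∉ K := fun h => hi₀ (hKT h)
  have hTK : T \ K ∪ K = T := Finset.sdiff_union_of_subset hKT
  have hinner : ∀ j ∈ K, (splitWeight τ η Λ₀ z₀ t (T \ K.erase j) (K.erase j) (x - 2 * η)
          * vermaA τ η Λ₀ z₀ (t i₀) x (K.erase j).card
          * exchangeCoeff τ η t i₀ (T \ K.erase j) j (y (K.erase j).card))
        • snocMap (K.erase j).card
          (Ψ (insert i₀ ((T \ K.erase j).erase j)) (y (K.erase j).card))
      = (splitWeight τ η Λ₀ z₀ t (insert j (T \ K)) (K.erase j) (x - 2 * η)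
          * vermaA τ η Λ₀ z₀ (t i₀) x (K.erase j).card
          * exchangeCoeff τ η t i₀ (insert j (T \ K)) j (y (K.card - 1)))
        • snocMap (K.card - 1) (Ψ (insert i₀ (T \ K)) (y (K.card - 1))) := by
    intro j hj
    have e1 : T \ K.erase j = insert j (T \ K) := by
      rw [Finset.sdiff_erase (hKT hj)]
    have e2 : (insert j (T \ K)).erase j = T \ K :=
      Finset.erase_insert fun h => (Finset.mem_sdiff.mp h).2 hj
    rw [e1, e2, cast_card_erase hj, Finset.card_erase_of_mem hj]
  have hright : ∀ j ∈ K, (exchangeCoeff τ η t i₀ T j x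
          * splitWeight τ η Λ₀ z₀ t (insert i₀ (T.erase j \ K.erase j)) (K.erase j) x)
          • snocMap (K.erase j).card (Ψ (insert i₀ (T.erase j \ K.erase j)) (y (K.erase j).card))
        + (exchangeCoeff τ η t i₀ T j x
          * splitWeight τ η Λ₀ z₀ t (T.erase j \ K.erase j) (insert i₀ (K.erase j)) x)
          • snocMap (insert i₀ (K.erase j)).card
            (Ψ (T.erase j \ K.erase j) (y (insert i₀ (K.erase j)).card))
      = (exchangeCoeff τ η t i₀ (T \ K ∪ K) j x
          * splitWeight τ η Λ₀ z₀ t (insert i₀ (T \ K)) (K.erase j) x)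
          • snocMap (K.card - 1) (Ψ (insert i₀ (T \ K)) (y (K.card - 1)))
        + (exchangeCoeff τ η t i₀ (T \ K ∪ K) j x
          * splitWeight τ η Λ₀ z₀ t (T \ K) (insert i₀ (K.erase j)) x)
          • snocMap K.card (Ψ (T \ K) (y K.card)) := by
    intro j hj
    have e1 : T.erase j \ K.erase j = T \ K := by
      ext i
      simp only [Finset.mem_sdiff, Finset.mem_erase]
      constructor
      · rintro ⟨⟨h1, h2⟩, h3⟩
        exact ⟨h2, fun h => h3 ⟨h1, h⟩⟩
      · rintro ⟨h1, h2⟩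
        exact ⟨⟨fun h => h2 (h ▸ hj), h1⟩, fun h => h2 h.2⟩
    have e2 : (insert i₀ (K.erase j)).card = K.card := by
      rw [Finset.card_insert_of_notMem fun h => hiK (Finset.mem_of_mem_erase h),
        Finset.card_erase_add_one hj]
    rw [e1, e2, hTK, cast_card_erase hj, Finset.card_erase_of_mem hj]
  have hdis : Disjoint (T \ K) K := Finset.sdiff_disjoint
  have hd := splitWeight_diagonal hτ η Λ₀ z₀ t hiK hdis
    (fun i hi j hj => ht i (hKT hi) j (hKT hj)) (fun j hj => ht₀ j (hKT hj))
    (fun j hj => hq j (Finset.insert_subset_insert i₀ hKT hj))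
    (fun j hj => hs K hK j (Finset.insert_subset_insert i₀ hKT hj)) hx
  have he := splitWeight_exchange hτ η Λ₀ z₀ hη t
    (fun h => hi₀ (Finset.mem_sdiff.mp h).1) hdis
    (fun i hi j hj => ht i (hKT hi) j (hKT hj)) (fun j hj => ht₀ j (hKT hj))
    (fun j hj => hq j (Finset.mem_insert_of_mem (hKT hj)))
    (fun j hj => hs1 K hK j (Finset.mem_insert_of_mem (hKT hj)))
    (fun j hj => hs2 K hK j (Finset.mem_insert_of_mem (hKT hj))) (hν K hK)
  rw [← hy] at he
  rw [Finset.sum_congr rfl hinner, Finset.sum_congr rfl hright, Finset.sum_add_distrib,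
    ← Finset.sum_smul, ← Finset.sum_smul, ← Finset.sum_smul, ← he, hd, hTK, smul_smul, add_smul,
    add_smul]
  abel

lemma tendsto_sub_const_codiscrete (a : ℂ) :
    Tendsto (fun x : ℂ => x - a) (codiscrete ℂ) (codiscrete ℂ) := by
  simpa only [sub_eq_add_neg] using tendsto_add_right_codiscrete (-a)

/-- The action of `b(t_0)` and `a(t_0)` on the weight vectors. -/
theorem eventually_raisesAt_and_exchangesAt {τ : ℂ} (hτ : 0 < τ.im) (η : ℂ)
    (hη : theta τ (2 * η) ≠ 0) (t : ι → ℂ) {n : ℕ} (Λ z : Fin n → ℂ) (i₀ : ι) (T : Finset ι)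
    (hi₀ : i₀ ∉ T) (ht : ∀ i ∈ T, ∀ j ∈ T, i ≠ j → theta τ (t i - t j) ≠ 0)
    (ht₀ : ∀ j ∈ T, theta τ (t i₀ - t j) ≠ 0)
    (hq : ∀ j ∈ insert i₀ T, ∀ k, theta τ (t j - qPar η (Λ k) (z k)) ≠ 0) :
    (∀ᶠ x in codiscrete ℂ, RaisesAt τ η t Λ z i₀ T x)
      ∧ ∀ᶠ x in codiscrete ℂ, ExchangesAt τ η t Λ z i₀ T x := by
  -- The two properties feed each other; the step uses both for T \ K, at finitely many shifts, so
  -- that only finitely many closed discrete sets are excluded.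
  induction n generalizing T with
  | zero =>
    refine ⟨Eventually.of_forall fun x => ?_, Eventually.of_forall fun x => ?_⟩
    · rw [RaisesAt, entryMap_zero_ne _ _ _ _ (by decide), weightVector,
        if_neg (Finset.insert_ne_empty i₀ T), smul_zero]
    · rw [ExchangesAt, entryMap_zero_same]
      simp only [weightVector, if_neg (Finset.insert_ne_empty i₀ _), smul_zero,
        Finset.sum_const_zero, add_zero]
      split_ifs with h
      · rw [h, Finset.prod_empty, one_smul]
      · rw [smul_zero]
  | succ n ih =>
    have ih' : ∀ K ∈ T.powerset,
        (∀ᶠ x in codiscrete ℂ,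
          RaisesAt τ η t (Λ ∘ Fin.castSucc) (z ∘ Fin.castSucc) i₀ (T \ K) x)
        ∧ ∀ᶠ x in codiscrete ℂ,
          ExchangesAt τ η t (Λ ∘ Fin.castSucc) (z ∘ Fin.castSucc) i₀ (T \ K) x := fun K _ =>
      ih (Λ ∘ Fin.castSucc) (z ∘ Fin.castSucc) (T \ K)
        (fun h => hi₀ (Finset.mem_sdiff.mp h).1)
        (fun i hi j hj => ht i (Finset.mem_sdiff.mp hi).1 j (Finset.mem_sdiff.mp hj).1)
        (fun j hj => ht₀ j (Finset.mem_sdiff.mp hj).1)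
        (fun j hj k => hq j (Finset.insert_subset_insert i₀ Finset.sdiff_subset hj) k.castSucc)
    have hs : ∀ c : Finset ι → ι → ℂ, ∀ᶠ x in codiscrete ℂ, ∀ K ∈ T.powerset, ∀ j ∈ insert i₀ T,
        theta τ (x + c K j) ≠ 0 := fun c =>
      (Finset.eventually_all _).mpr fun K _ => (Finset.eventually_all _).mpr fun j _ =>
        eventually_theta_add_ne_zero hτ (c K j)
    have hν : ∀ c : Finset ι → ℂ, ∀ᶠ x in codiscrete ℂ, ∀ K ∈ T.powerset,
        theta τ (x - c K) ≠ 0 := fun c =>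
      (Finset.eventually_all _).mpr fun K _ => eventually_theta_sub_ne_zero hτ (c K)
    have hB : ∀ c : Finset ι → ℂ, ∀ᶠ x in codiscrete ℂ, ∀ K ∈ T.powerset,
        RaisesAt τ η t (Λ ∘ Fin.castSucc) (z ∘ Fin.castSucc) i₀ (T \ K) (x - c K) := fun c =>
      (Finset.eventually_all _).mpr fun K hK =>
        (tendsto_sub_const_codiscrete (c K)).eventually (ih' K hK).1
    have hA : ∀ c : Finset ι → ℂ, ∀ᶠ x in codiscrete ℂ, ∀ K ∈ T.powerset,
        ExchangesAt τ η t (Λ ∘ Fin.castSucc) (z ∘ Fin.castSucc) i₀ (T \ K) (x - c K) := fun c =>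
      (Finset.eventually_all _).mpr fun K hK =>
        (tendsto_sub_const_codiscrete (c K)).eventually (ih' K hK).2
    set q := qPar η (Λ (Fin.last n)) (z (Fin.last n)) with hqdef
    constructor
    · filter_upwards [hs fun K j => -q + 2 * η * K.card + t j, hν _, hB _, hA _]
        with x h1 h2 h3 h4
      refine raisesAt_succ hτ η t Λ z hi₀ ht ht₀ (fun K hK j hj => ?_) h2 h3 h4
      convert h1 K hK j hj using 2
      ring
    · filter_upwards [eventually_theta_ne_zero hτ, hs fun K j => -q + 2 * η * K.card + t j,
        hs fun K j => -q + 2 * η * (K.card - 1) + t j,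
        hs fun K j => -q + 2 * η * (K.card - 1) + t j - 2 * η, hν _, hB _, hA _]
        with x h0 h1 h1' h1'' h2 h3 h4
      refine exchangesAt_succ hτ η hη t Λ z hi₀ ht ht₀ (fun j hj => hq j hj _) h0
        (fun K hK j hj => ?_) (fun K hK j hj => ?_) (fun K hK j hj => ?_) h2 h3 h4
      · convert h1 K hK j hj using 2
        ring
      · convert h1' K hK j hj using 2
        ring
      · convert h1'' K hK j hj using 2
        ring

end WeightVectors

end EllipticBethe

end

noncomputable section

namespace EllipticBethe

open Filter Topology

/-! ### The explicit formula -/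

section Formula

/-- `I` is an ordered partition of `T`. -/
def IsOrderedPartition {n m : ℕ} (T : Finset (Fin m)) (I : Fin n → Finset (Fin m)) : Prop :=
  (∀ l, I l ⊆ T) ∧ ∀ i ∈ T, ∃! l, i ∈ I l

open Classical in
/-- The ordered partitions of `T` into `n` subsets. -/
def partitionsOf (n : ℕ) {m : ℕ} (T : Finset (Fin m)) : Finset (Fin n → Finset (Fin m)) :=
  Finset.univ.filter fun I => IsOrderedPartition T I

lemma mem_partitionsOf {n m : ℕ} {T : Finset (Fin m)} {I : Fin n → Finset (Fin m)} :
    I ∈ partitionsOf n T ↔ IsOrderedPartition T I := by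
  simp [partitionsOf]

lemma partitionsOf_univ (n m : ℕ) :
    partitionsOf n (Finset.univ : Finset (Fin m)) = partitions n m := by
  ext I
  simp [mem_partitionsOf, IsOrderedPartition, partitions]

lemma IsOrderedPartition.prod_prod {n m : ℕ} {T : Finset (Fin m)} {I : Fin n → Finset (Fin m)}
    (h : IsOrderedPartition T I) (f : Fin m → ℂ) : ∏ l, ∏ i ∈ I l, f i = ∏ i ∈ T, f i := by
  have hT : T = Finset.univ.biUnion I := by
    ext i
    simp only [Finset.mem_biUnion, Finset.mem_univ, true_and]
    exact ⟨fun hi => (h.2 i hi).exists, fun ⟨l, hl⟩ => h.1 l hl⟩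
  rw [hT, Finset.prod_biUnion]
  intro k _ l _ hkl
  rw [Function.onFun, Finset.disjoint_left]
  intro i hk hl
  exact hkl ((h.2 i (h.1 k hk)).unique hk hl)

lemma isOrderedPartition_succ {n m : ℕ} {T : Finset (Fin m)} {I : Fin (n + 1) → Finset (Fin m)} :
    IsOrderedPartition T I ↔ I (Fin.last n) ⊆ T
      ∧ IsOrderedPartition (T \ I (Fin.last n)) (I ∘ Fin.castSucc) := by
  constructor
  · rintro ⟨h1, h2⟩
    refine ⟨h1 _, fun l i hi => Finset.mem_sdiff.mpr ⟨h1 _ hi, fun hl => ?_⟩, fun i hi => ?_⟩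
    · exact (Fin.castSucc_lt_last l).ne ((h2 i (h1 _ hi)).unique hi hl)
    · obtain ⟨hiT, hil⟩ := Finset.mem_sdiff.mp hi
      obtain ⟨l, hl, hu⟩ := h2 i hiT
      induction l using Fin.lastCases with
      | last => exact absurd hl hil
      | cast l => exact ⟨l, hl, fun k hk => Fin.castSucc_injective n (hu _ hk)⟩
  · rintro ⟨h0, h1, h2⟩
    refine ⟨fun l => ?_, fun i hi => ?_⟩
    · induction l using Fin.lastCases with
      | last => exact h0
      | cast l => exact (h1 l).trans Finset.sdiff_subset
    · by_cases hil : i ∈ I (Fin.last n)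
      · refine ⟨_, hil, fun k hk => ?_⟩
        induction k using Fin.lastCases with
        | last => rfl
        | cast k => exact absurd hil (Finset.mem_sdiff.mp (h1 k hk)).2
      · obtain ⟨l, hl, hu⟩ := h2 i (Finset.mem_sdiff.mpr ⟨hi, hil⟩)
        refine ⟨l.castSucc, hl, fun k hk => ?_⟩
        induction k using Fin.lastCases with
        | last => exact absurd hk hil
        | cast k => exact congr_arg _ (hu k hk)

lemma prod_Ioi_castSucc {n : ℕ} (i : Fin n) (f : Fin (n + 1) → ℂ) :
    ∏ l ∈ Finset.Ioi i.castSucc, f l = (∏ l ∈ Finset.Ioi i, f l.castSucc) * f (Fin.last n) :=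
  sum_Ioi_castSucc (M := Additive ℂ) i f

lemma Ioi_last (n : ℕ) : Finset.Ioi (Fin.last n) = ∅ := by
  ext l; simp [Fin.le_last]

/-- The factors involving the last index form `splitWeight`; in the others the weight of the last
factor is absorbed into the shift of x. -/
lemma betheCoeff_succ (τ η : ℂ) {n m : ℕ} (Λ z : Fin (n + 1) → ℂ) (t : Fin m → ℂ)
    {T : Finset (Fin m)} {I : Fin (n + 1) → Finset (Fin m)} (h : IsOrderedPartition T I) (x : ℂ) :
    betheCoeff τ η Λ z t I x
      = splitWeight τ η (Λ (Fin.last n)) (z (Fin.last n)) t (T \ I (Fin.last n)) (I (Fin.last n)) x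
        * betheCoeff τ η (Λ ∘ Fin.castSucc) (z ∘ Fin.castSucc) t (I ∘ Fin.castSucc)
          (x - 2 * η * (Λ (Fin.last n) - 2 * (I (Fin.last n)).card)) := by
  have hI := (isOrderedPartition_succ.mp h).2
  rw [splitWeight, splitFactor, ← hI.prod_prod, ← hI.prod_prod]
  simp only [betheCoeff, Fin.prod_univ_castSucc, prod_Ioi_castSucc, sum_Ioi_castSucc, Ioi_last,
    Finset.prod_empty, Finset.sum_empty, Finset.prod_const_one, mul_one, mul_zero, sub_zero,
    Finset.prod_mul_distrib, Function.comp_apply, pairFactor]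
  have harg : ∀ (k : Fin n) (j : Fin m) (S : ℂ),
      x + t j - qPar η (Λ k.castSucc) (z k.castSucc) + 2 * η * ((I k.castSucc).card : ℂ)
        - 2 * η * (S + (Λ (Fin.last n) - 2 * ((I (Fin.last n)).card : ℂ)))
      = x - 2 * η * (Λ (Fin.last n) - 2 * ((I (Fin.last n)).card : ℂ)) + t j
        - qPar η (Λ k.castSucc) (z k.castSucc) + 2 * η * ((I k.castSucc).card : ℂ)
        - 2 * η * S := fun k j S => by ring
  simp only [harg]
  ring

/-- The weight vector is the sum over ordered partitions. -/
lemma weightVector_eq_sum (τ η : ℂ) {m : ℕ} (t : Fin m → ℂ) {n : ℕ} (Λ z : Fin n → ℂ)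
    (T : Finset (Fin m)) (x : ℂ) :
    weightVector τ η t n Λ z T x = ∑ I ∈ partitionsOf n T,
      betheCoeff τ η Λ z t I x • Finsupp.single (fun k => (I k).card) (1 : ℂ) := by
  induction n generalizing T x with
  | zero =>
    rw [weightVector]
    split_ifs with hT
    · have : partitionsOf 0 T = {Fin.elim0} := by
        ext I
        simp [mem_partitionsOf, IsOrderedPartition, hT, eq_iff_true_of_subsingleton]
      rw [this, Finset.sum_singleton]
      simp [betheCoeff]
    · have : partitionsOf 0 T = ∅ := by
        ext I
        obtain ⟨i, hi⟩ := Finset.nonempty_iff_ne_empty.mpr hT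
        simp only [mem_partitionsOf, IsOrderedPartition, Finset.notMem_empty, iff_false, not_and]
        exact fun _ h => (h i hi).exists.elim fun l => l.elim0
      rw [this, Finset.sum_empty]
  | succ n ih =>
    rw [weightVector_succ]
    simp only [ih, map_sum, map_smul, snocMap_single, Finset.smul_sum, smul_smul]
    rw [Finset.sum_sigma']
    refine Finset.sum_bij'
      (fun (a : Σ _ : Finset (Fin m), Fin n → Finset (Fin m)) _ =>
        (Fin.snoc a.2 a.1 : Fin (n + 1) → Finset (Fin m)))
      (fun I _ => ⟨I (Fin.last n), I ∘ Fin.castSucc⟩) ?_ ?_ ?_ ?_ ?_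
    · rintro ⟨K, I⟩ h
      simp only [Finset.mem_sigma, Finset.mem_powerset, mem_partitionsOf] at h
      rw [mem_partitionsOf, isOrderedPartition_succ]
      simpa [Function.comp_def] using h
    · intro I h
      rw [mem_partitionsOf, isOrderedPartition_succ] at h
      simpa [mem_partitionsOf] using h
    · rintro ⟨K, I⟩ _
      simp [Function.comp_def]
    · intro I _
      exact Fin.snoc_init_self I
    · rintro ⟨K, I⟩ h
      simp only [Finset.mem_sigma, Finset.mem_powerset, mem_partitionsOf] at h
      have hp : IsOrderedPartition T (Fin.snoc I K : Fin (n + 1) → Finset (Fin m)) := by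
        rw [isOrderedPartition_succ]
        simpa [Function.comp_def] using h
      rw [betheCoeff_succ τ η Λ z t hp]
      have hc : (Fin.snoc I K : Fin (n + 1) → Finset (Fin m)) ∘ Fin.castSucc = I := by
        funext l; simp
      rw [hc, Fin.snoc_last]
      congr 2
      funext k
      induction k using Fin.lastCases with
      | last => simp
      | cast k => simp

lemma weightVector_empty (τ η : ℂ) {m : ℕ} (t : Fin m → ℂ) {n : ℕ} (Λ z : Fin n → ℂ) (x : ℂ) :
    weightVector τ η t n Λ z ∅ x = Finsupp.single (fun _ => 0) 1 := by
  induction n generalizing x with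
  | zero =>
    rw [weightVector, if_pos rfl]
    congr 1
    exact Subsingleton.elim _ _
  | succ n ih =>
    rw [weightVector_succ, Finset.powerset_empty, Finset.sum_singleton, Finset.sdiff_empty, ih,
      snocMap_single]
    have h1 : splitWeight τ η (Λ (Fin.last n)) (z (Fin.last n)) t ∅ ∅ x = 1 := by
      simp [splitWeight, splitFactor]
    rw [h1, one_smul]
    congr 1
    funext k
    induction k using Fin.lastCases with
    | last => simp
    | cast k => simp

lemma bOp_apply (τ η : ℂ) {n : ℕ} (Λ z : Fin n → ℂ) (w : ℂ) (f : ℂ → TensorSpace n) (x : ℂ) :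
    bOp τ η Λ z w f x = entryMap τ η Λ z 1 (-1) w x (f (x + 2 * η)) := by
  rw [bOp, entryOp_apply]
  congr 2
  simp

/-- Each b contributes -θ(2η)/θ(x) and evaluates what follows at x + 2η, so the denominators run
through the points x + 2ηj and the scalar function g is evaluated at the end of this chain. -/
lemma foldr_bOp_eventuallyEq {τ : ℂ} (hτ : 0 < τ.im) (η : ℂ) (hη : theta τ (2 * η) ≠ 0)
    {n m : ℕ} (Λ z : Fin n → ℂ) (t : Fin m → ℂ)
    (htq : ∀ i k, theta τ (t i - qPar η (Λ k) (z k)) ≠ 0)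
    (htt : ∀ i j, i ≠ j → theta τ (t i - t j) ≠ 0) (g : ℂ → ℂ) (l : List (Fin m))
    (hl : l.Nodup) :
    l.foldr (fun i f => bOp τ η Λ z (t i) f) (fun x => Finsupp.single (fun _ => 0) (g x))
      =ᶠ[codiscrete ℂ] fun x => ((-theta τ (2 * η)) ^ l.length
        / (∏ j ∈ Finset.range l.length, theta τ (x + 2 * η * j)) * g (x + 2 * η * l.length))
          • weightVector τ η t n Λ z l.toFinset x := by
  induction l with
  | nil =>
    refine Eventually.of_forall fun x => ?_
    simp [weightVector_empty]
  | cons i l ih =>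
    obtain ⟨hi, hl⟩ := List.nodup_cons.mp hl
    have hi' : i ∉ l.toFinset := by simpa using hi
    have hraise := (eventually_raisesAt_and_exchangesAt hτ η hη t Λ z i l.toFinset hi'
      (fun i _ j _ => htt i j) (fun j hj => htt i j fun h => hi' (h ▸ hj))
      (fun j _ k => htq j k)).1
    filter_upwards [(tendsto_add_right_codiscrete (2 * η)).eventually (ih hl), hraise] with x h1 h2
    rw [RaisesAt] at h2
    rw [List.foldr_cons, bOp_apply, h1, map_smul, h2, smul_smul, List.toFinset_cons,
      List.length_cons, Finset.prod_range_succ', pow_succ]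
    have hprod : ∏ j ∈ Finset.range l.length, theta τ (x + 2 * η * ((j + 1 : ℕ) : ℂ))
        = ∏ j ∈ Finset.range l.length, theta τ (x + 2 * η + 2 * η * j) :=
      Finset.prod_congr rfl fun j _ => by
        congr 1; push_cast; ring
    have harg : x + 2 * η * ((l.length + 1 : ℕ) : ℂ) = x + 2 * η + 2 * η * l.length := by
      push_cast; ring
    rw [hprod, harg, Nat.cast_zero, mul_zero, add_zero]
    congr 1
    ring

/-- The reflection j ↦ m - j identifies the theta factors of the starting vector, shifted by 2ηm,
with the denominators left by the m operators. -/
lemma prod_theta_Icc (τ η x : ℂ) (m : ℕ) :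
    ∏ j ∈ Finset.Icc 1 m, theta τ (x + 2 * η * m - 2 * η * (j : ℂ))
      = ∏ j ∈ Finset.range m, theta τ (x + 2 * η * j) := by
  rw [← Finset.prod_range_reflect, ← Finset.Ico_succ_right_eq_Icc, Finset.prod_Ico_eq_prod_range]
  refine Finset.prod_congr (by simp) fun j hj => ?_
  have hj' : j < m := by simpa using hj
  congr 1
  rw [Nat.sub_sub, Nat.cast_sub (by lia)]
  push_cast
  ring

/-- The Bethe vector as a sum over ordered partitions. -/
lemma betheVector_eventuallyEq {τ : ℂ} (hτ : 0 < τ.im) (η : ℂ) (hη : theta τ (2 * η) ≠ 0)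
    {n m : ℕ} (Λ z : Fin n → ℂ) (c : ℂ) (t : Fin m → ℂ)
    (htq : ∀ i k, theta τ (t i - qPar η (Λ k) (z k)) ≠ 0)
    (htt : ∀ i j, i ≠ j → theta τ (t i - t j) ≠ 0) :
    betheVector τ η Λ z c t =ᶠ[codiscrete ℂ]
      fun x => ((-1) ^ m * Complex.exp (c * (x + 2 * η * m))) •
        ∑ I ∈ partitions n m, betheCoeff τ η Λ z t I x •
            Finsupp.single (fun k => (I k).card) (1 : ℂ) := by
  have h := foldr_bOp_eventuallyEq hτ η hη Λ z t htq htt (fun x => Complex.exp (c * x)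
      * ∏ j ∈ Finset.Icc 1 m, (theta τ (x - 2 * η * (j : ℂ)) / theta τ (2 * η)))
      (List.finRange m) (List.nodup_finRange m)
  have hne : ∀ᶠ x in codiscrete ℂ, ∀ j ∈ Finset.range m, theta τ (x + 2 * η * j) ≠ 0 :=
    (Finset.eventually_all _).mpr fun j _ => eventually_theta_add_ne_zero hτ _
  filter_upwards [h, hne] with x hx hx0
  have hP : ∏ j ∈ Finset.range m, theta τ (x + 2 * η * j) ≠ 0 := Finset.prod_ne_zero_iff.mpr hx0
  have hfold : betheVector τ η Λ z c t x = _ := hx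
  have hscalar : (-theta τ (2 * η)) ^ m / (∏ j ∈ Finset.range m, theta τ (x + 2 * η * j))
      * (Complex.exp (c * (x + 2 * η * m))
        * ∏ j ∈ Finset.Icc 1 m, (theta τ (x + 2 * η * m - 2 * η * (j : ℂ)) / theta τ (2 * η)))
      = (-1) ^ m * Complex.exp (c * (x + 2 * η * m)) := by
    rw [Finset.prod_div_distrib, prod_theta_Icc, Finset.prod_const, Nat.card_Icc,
      Nat.add_sub_cancel, neg_pow]
    field_simp
  rw [hfold, List.length_finRange, hscalar, List.toFinset_finRange, weightVector_eq_sum,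
    partitionsOf_univ]

lemma prod_const_of_mem_partitions {n m : ℕ} {I : Fin n → Finset (Fin m)}
    (h : I ∈ partitions n m) (a : ℂ) : ∏ k, ∏ _j ∈ I k, a = a ^ m := by
  rw [← partitionsOf_univ, mem_partitionsOf] at h
  rw [h.prod_prod fun _ => a, Finset.prod_const, Finset.card_univ, Fintype.card_fin]

/-- Each of the m variables lies in exactly one I_k and contributes one theta factor depending on x,
hence one sign. -/
lemma betheCoeff_add_one (τ η : ℂ) {n m : ℕ} (Λ z : Fin n → ℂ) (t : Fin m → ℂ)
    {I : Fin n → Finset (Fin m)} (h : I ∈ partitions n m) (x : ℂ) :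
    betheCoeff τ η Λ z t I (x + 1) = (-1) ^ m * betheCoeff τ η Λ z t I x := by
  have hterm : ∀ (k : Fin n) (j : Fin m) (S : ℂ),
      theta τ (x + 1 + t j - qPar η (Λ k) (z k) + 2 * η * ((I k).card : ℂ) - 2 * η * S)
          / theta τ (t j - qPar η (Λ k) (z k))
      = -1 * (theta τ (x + t j - qPar η (Λ k) (z k) + 2 * η * ((I k).card : ℂ) - 2 * η * S)
          / theta τ (t j - qPar η (Λ k) (z k))) := fun k j S => by
    rw [show x + 1 + t j - qPar η (Λ k) (z k) + 2 * η * ((I k).card : ℂ) - 2 * η * S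
      = x + t j - qPar η (Λ k) (z k) + 2 * η * ((I k).card : ℂ) - 2 * η * S + 1 by ring,
      theta_add_one, neg_div, neg_one_mul]
  simp only [betheCoeff, hterm, Finset.prod_mul_distrib, prod_const_of_mem_partitions h]
  ring

lemma differentiable_betheCoeff {τ : ℂ} (hτ : 0 < τ.im) (η : ℂ) {n m : ℕ} (Λ z : Fin n → ℂ)
    (t : Fin m → ℂ) (I : Fin n → Finset (Fin m)) :
    Differentiable ℂ (betheCoeff τ η Λ z t I) := by
  have := differentiable_theta hτ
  unfold betheCoeff
  fun_prop

end Formula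

end EllipticBethe

end

theorem mainTheorem2 (τ η : ℂ) (hτ : 0 < τ.im) (hη : 2 * η ∉ EllipticBethe.lattice τ)
    (n m : ℕ) (Λ z : Fin n → ℂ) (c : ℂ) (t : Fin m → ℂ)
    (htq : ∀ i k, t i - EllipticBethe.qPar η (Λ k) (z k) ∉ EllipticBethe.lattice τ)
    (htt : ∀ i j, i < j → t i - t j ∉ EllipticBethe.lattice τ) :
    EllipticBethe.betheVector τ η Λ z c t =ᶠ[Filter.codiscrete ℂ]
      (fun x => ((-1) ^ m * Complex.exp (c * (x + 2 * η * m))) •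
        ∑ I ∈ EllipticBethe.partitions n m,
          EllipticBethe.betheCoeff τ η Λ z t I x •
            Finsupp.single (fun k => (I k).card) (1 : ℂ)) ∧
    ∃ ψ : ℂ → EllipticBethe.TensorSpace n,
      EllipticBethe.betheVector τ η Λ z c t =ᶠ[Filter.codiscrete ℂ] ψ ∧
      EllipticBethe.IsEntire ψ ∧
      ∀ x, ψ (x + 1) = ((-1) ^ m * Complex.exp c) • ψ x := by
  have hη' : EllipticBethe.theta τ (2 * η) ≠ 0 := EllipticBethe.theta_ne_zero hτ hη
  have htt' : ∀ i j, i ≠ j → EllipticBethe.theta τ (t i - t j) ≠ 0 := fun i j hij => by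
    rcases lt_or_gt_of_ne hij with h | h
    · exact EllipticBethe.theta_ne_zero hτ (htt i j h)
    · rw [EllipticBethe.theta_sub_comm]
      exact neg_ne_zero.mpr (EllipticBethe.theta_ne_zero hτ (htt j i h))
  have hmain := EllipticBethe.betheVector_eventuallyEq hτ η hη' Λ z c t
    (fun i k => EllipticBethe.theta_ne_zero hτ (htq i k)) htt'
  -- The extension ψ is the explicit formula itself: its denominators do not involve x, and its
  -- support lies among the finitely many tuples of cardinalities.
  refine ⟨hmain, _, hmain, ⟨⟨(EllipticBethe.partitions n m).image fun I k => (I k).card,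
    fun x => ?_⟩, fun κ => ?_⟩, fun x => ?_⟩
  · classical
    refine Finsupp.support_smul.trans (Finsupp.support_finsetSum.trans ?_)
    refine Finset.biUnion_subset.mpr fun I hI => Finsupp.support_smul.trans
      (Finsupp.support_single_subset.trans ?_)
    rw [Finset.singleton_subset_iff]
    exact Finset.mem_image_of_mem _ hI
  · have := fun I => EllipticBethe.differentiable_betheCoeff hτ η Λ z t I
    simp only [Finsupp.smul_apply, Finsupp.finsetSum_apply, smul_eq_mul]
    fun_prop
  · have hexp : Complex.exp (c * (x + 1 + 2 * η * m))
        = Complex.exp c * Complex.exp (c * (x + 2 * η * m)) := by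
      rw [← Complex.exp_add]
      congr 1
      ring
    have hsum : ∑ I ∈ EllipticBethe.partitions n m, EllipticBethe.betheCoeff τ η Λ z t I (x + 1)
          • Finsupp.single (fun k => (I k).card) (1 : ℂ)
        = ((-1) ^ m : ℂ) • ∑ I ∈ EllipticBethe.partitions n m,
          EllipticBethe.betheCoeff τ η Λ z t I x
            • Finsupp.single (fun k => (I k).card) (1 : ℂ) := by
      rw [Finset.smul_sum]
      refine Finset.sum_congr rfl fun I hI => ?_
      rw [EllipticBethe.betheCoeff_add_one τ η Λ z t hI, smul_smul]
    rw [hexp, hsum, smul_smul, smul_smul]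
    congr 1
    ring
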